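/- Let $X$ be a compact connected Riemann surface, $L$ a holomorphic line bundle on $X$, $p,q\ge 1$ integers, and let $E=(V,W,\beta,\gamma)$ be an $L$-twisted $\mathrm{U}(p,q)$-Higgs bundle: $V$ and $W$ are holomorphic vector bundles on $X$ of ranks $p$ and $q$, and $\beta\colon W\to V\otimes L$, $\gamma\colon V\to W\otimes L$ are holomorphic maps. Write $\mu=\deg/\operatorname{rk}$. A subobject of $E$ is a pair of subbundles $V'\subset V$, $W'\subset W$, of ranks $p',q'$, with $\beta(W')\subset V'\otimes L$ and $\gamma(V')\subset W'\otimes L$; its $\alpha$-slope is $\frac{\deg V'+\deg W'}{p'+q'}+\alpha\frac{p'}{p'+q'}$. Let $\alpha\in\mathbb R$ and suppose that $E$ is $\alpha$-semistable: every subobject other than $0$ and $E$ has $\alpha$-slope at most that of $E$. Let $\operatorname{rk}(\ker\beta)$ and $\operatorname{rk}(\ker\gamma)$ denote the ranks of the kernel sheaves, and let injectivity be that of morphisms of sheaves of sections. For integers $i,j$ such that the respective denominator is nonzero put $$\alpha_i=\frac{2pq}{q(p-q)+(i+1)(p+q)}\bigl(\mu(W)-\mu(V)-\deg L\bigr)+\deg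 L,$$ $$\alpha'_j=\frac{2pq}{p(q-p)+(j+1)(p+q)}\bigl(\mu(W)-\mu(V)+\deg L\bigr)-\deg L.$$ Then: (i) Assume $p\ge q$ and $\mu(V)-\mu(W)>-\deg L$. For $1\le i\le q$, if $\alpha<\alpha_{i-1}$ then $\operatorname{rk}(\ker\beta)<i$. In particular $\beta$ is injective whenever $$\alpha<\alpha_0=\frac{2pq}{pq-q^2+p+q}\bigl(\mu(W)-\mu(V)-\deg L\bigr)+\deg L.$$ (ii) Assume $p\ge q$ and $\mu(V)-\mu(W)<-\deg L$. For $1\le i\le q$, if $\alpha<\alpha_{i-1}$ then $\operatorname{rk}(\ker\beta)>i$. In particular, if $(p,q)\ne(1,1)$, then $\beta=0$ whenever $$\alpha<\alpha_{q-2}=\frac{2pq}{2pq-p-q}\bigl(\mu(W)-\mu(V)-\deg L\bigr)+\deg L.$$ (iii) Assume $p\le q$ and $\mu(V)-\mu(W)<\deg L$. For $1\le j\le p$, if $\alpha>\alpha'_{j-1}$ then $\operatorname{rk}(\ker\gamma)<j$. In particular $\gamma$ is injective whenever $$\alpha>\alpha'_0=\frac{2pq}{pq-p^2+p+q}\bigl(\mu(W)-\mu(V)+\deg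 L\bigr)-\deg L.$$ (iv) Assume $p\le q$ and $\mu(V)-\mu(W)>\deg L$. For $1\le j\le p$, if $\alpha>\alpha'_{j-1}$ then $\operatorname{rk}(\ker\gamma)>j$. In particular, if $(p,q)\ne(1,1)$, then $\gamma=0$ whenever $$\alpha>\alpha'_{p-2}=\frac{2pq}{2pq-p-q}\bigl(\mu(W)-\mu(V)+\deg L\bigr)-\deg L.$$ -/

import Mathlib

open Bundle Set MeasureTheory
open scoped Manifold ContDiff TensorProduct ComplexConjugate

universe u v v₁ v₂ v₃

noncomputable section

/-- A complex manifold of dimension one is, in the same charts, a smooth real surface. -/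
theorem isManifold_real_of_complex (X : Type u) [TopologicalSpace X] [ChartedSpace ℂ X]
    [IsManifold 𝓘(ℂ) ω X] : IsManifold 𝓘(ℝ, ℂ) ∞ X := by
  apply isManifold_of_contDiffOn
  intro e e' he he'
  have h := (mem_groupoid_of_pregroupoid.1
    ((contDiffGroupoid ω 𝓘(ℂ)).compatible he he')).1
  simp only [contDiffPregroupoid, mfld_simps] at h ⊢
  exact (h.restrict_scalars ℝ).of_le le_top

/-- A holomorphic function is smooth as a function on the underlying real surface. -/
theorem contMDiffOn_real_of_complex {X : Type u} [TopologicalSpace X] [ChartedSpace ℂ X]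
    {F : Type*} [NormedAddCommGroup F] [NormedSpace ℂ F]
    {f : X → F} {U : Set X} (hf : ContMDiffOn 𝓘(ℂ) 𝓘(ℂ, F) ω f U) :
    ContMDiffOn 𝓘(ℝ, ℂ) 𝓘(ℝ, F) ∞ f U := by
  intro x hx
  have h := hf x hx
  rw [contMDiffWithinAt_iff] at h ⊢
  refine ⟨h.1, ?_⟩
  have h2 := h.2
  simp only [mfld_simps] at h2 ⊢
  exact (h2.restrict_scalars ℝ).of_le le_top

/-- A holomorphic vector bundle of rank `r` on `X`. -/
structure HolVB (X : Type u) [TopologicalSpace X] [ChartedSpace ℂ X] [IsManifold 𝓘(ℂ) ω X]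
    (r : ℕ) where
  Fiber : X → Type v
  [addCommGroup : ∀ x, AddCommGroup (Fiber x)]
  [module : ∀ x, Module ℂ (Fiber x)]
  [topFiber : ∀ x, TopologicalSpace (Fiber x)]
  [topTotal : TopologicalSpace (TotalSpace (EuclideanSpace ℂ (Fin r)) Fiber)]
  [fiberBundle : FiberBundle (EuclideanSpace ℂ (Fin r)) Fiber]
  [vectorBundle : VectorBundle ℂ (EuclideanSpace ℂ (Fin r)) Fiber]
  [holomorphic : ContMDiffVectorBundle ω (EuclideanSpace ℂ (Fin r)) Fiber 𝓘(ℂ)]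

attribute [instance] HolVB.addCommGroup HolVB.module HolVB.topFiber HolVB.topTotal
  HolVB.fiberBundle HolVB.vectorBundle HolVB.holomorphic

variable {X : Type u} [TopologicalSpace X] [ChartedSpace ℂ X] [IsManifold 𝓘(ℂ) ω X]

namespace HolVB

variable {r : ℕ} (V : HolVB.{u, v} X r)

/-- `s` restricts to a holomorphic section of `V` over `U`. -/
def IsHolOn (U : Set X) (s : ∀ x, V.Fiber x) : Prop :=
  ContMDiffOn 𝓘(ℂ) (𝓘(ℂ).prod 𝓘(ℂ, EuclideanSpace ℂ (Fin r))) ω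
    (fun x => TotalSpace.mk' (EuclideanSpace ℂ (Fin r)) x (s x)) U

/-- A holomorphic subbundle of `V`: a family of subspaces of the fibres which is locally spanned
by a pointwise linearly independent family of holomorphic sections. -/
structure Sub where
  carrier : ∀ x, Submodule ℂ (V.Fiber x)
  rank : ℕ
  exists_frame : ∀ x, ∃ U : Set X, IsOpen U ∧ x ∈ U ∧ ∃ s : Fin rank → ∀ y, V.Fiber y,
    (∀ i, V.IsHolOn U (s i)) ∧ ∀ y ∈ U,
      LinearIndependent ℂ (fun i => s i y) ∧
      Submodule.span ℂ (range fun i => s i y) = carrier y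

/-- `V` as a subbundle of itself. -/
def top : V.Sub where
  carrier _ := ⊤
  rank := r
  exists_frame x := by
    let e := trivializationAt (EuclideanSpace ℂ (Fin r)) V.Fiber x
    let b := (EuclideanSpace.basisFun (Fin r) ℂ).toBasis
    have h := e.isLocalFrameOn_localFrame_baseSet 𝓘(ℂ) ω b
    refine ⟨e.baseSet, e.open_baseSet, mem_baseSet_trivializationAt _ _ x, e.localFrame b,
      fun i => h.contMDiffOn i, fun y hy => ⟨h.linearIndependent hy, ?_⟩⟩
    exact top_unique (h.generating hy)

/-- A smooth Hermitian metric on `V`, conjugate-linear in the first variable. -/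
structure HermitianMetric where
  form : ∀ x, V.Fiber x →ₗ⋆[ℂ] V.Fiber x →ₗ[ℂ] ℂ
  conj_symm : ∀ x v w, conj (form x v w) = form x w v
  pos : ∀ x v, v ≠ 0 → 0 < (form x v v).re
  smooth : ∀ (U : Set X) (s t : ∀ x, V.Fiber x), IsOpen U → V.IsHolOn U s → V.IsHolOn U t →
    ContMDiffOn 𝓘(ℝ, ℂ) 𝓘(ℝ, ℂ) ∞ (fun x => form x (s x) (t x)) U

theorem nonempty_hermitianMetric [T2Space X] [CompactSpace X] : Nonempty V.HermitianMetric := by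
  have := isManifold_real_of_complex X
  let F := EuclideanSpace ℂ (Fin r)
  let e := fun c : X => trivializationAt F V.Fiber c
  obtain ⟨ρ, hρ⟩ := SmoothPartitionOfUnity.exists_isSubordinate 𝓘(ℝ, ℂ)
    (isClosed_univ (X := X)) (fun c : X => (e c).baseSet) (fun c => (e c).open_baseSet)
    (fun x _ => mem_iUnion_of_mem x (mem_baseSet_trivializationAt F V.Fiber x))
  let b : ∀ _ x : X, V.Fiber x →ₗ⋆[ℂ] V.Fiber x →ₗ[ℂ] ℂ := fun c x =>
    ((innerₛₗ ℂ (E := F)).comp ((e c).linearMapAt ℂ x)).compl₂ ((e c).linearMapAt ℂ x)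
  have hb : ∀ c x v w, b c x v w =
      inner ℂ ((e c).linearMapAt ℂ x v) ((e c).linearMapAt ℂ x w) := fun _ _ _ _ => rfl
  let h : ∀ x : X, V.Fiber x →ₗ⋆[ℂ] V.Fiber x →ₗ[ℂ] ℂ := fun x =>
    ∑ c ∈ ρ.finsupport x, (ρ c x : ℂ) • b c x
  have hh : ∀ x v w, h x v w = ∑ c ∈ ρ.finsupport x, (ρ c x : ℂ) * b c x v w := by
    intro x v w; simp [h, LinearMap.sum_apply]
  refine ⟨⟨h, ?_, ?_, ?_⟩⟩
  · intro x v w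
    rw [hh, hh, map_sum]
    refine Finset.sum_congr rfl fun c _ => ?_
    rw [map_mul, hb, hb, inner_conj_symm, Complex.conj_ofReal]
  · intro x v hv
    rw [hh, Complex.re_sum]
    have key : ∀ c, ((ρ c x : ℂ) * b c x v v).re
        = ρ c x * ‖(e c).linearMapAt ℂ x v‖ ^ 2 := by
      intro c
      rw [hb, inner_self_eq_norm_sq_to_K, Complex.re_ofReal_mul]
      norm_cast
    simp only [key]
    obtain ⟨c, hc⟩ : ∃ c, 0 < ρ c x := by
      by_contra! hcon
      have h1 := ρ.sum_eq_one (mem_univ x)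
      rw [finsum_congr (fun c => le_antisymm (hcon c) (ρ.nonneg c x)), finsum_zero] at h1
      exact zero_ne_one h1
    refine Finset.sum_pos' (fun c _ => mul_nonneg (ρ.nonneg c x) (by positivity))
      ⟨c, (ρ.mem_finsupport x).2 hc.ne', mul_pos hc ?_⟩
    have hx : x ∈ (e c).baseSet := hρ c (subset_tsupport _ hc.ne')
    have : (e c).linearMapAt ℂ x v ≠ 0 := by
      intro h0
      apply hv
      rw [Trivialization.linearMapAt_apply, if_pos hx] at h0
      exact ((e c).continuousLinearEquivAt ℂ x hx).map_eq_zero_iff.1 h0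
    positivity
  · intro U s t hU hs ht
    have heq : (fun x => h x (s x) (t x)) =
        fun x => ∑ᶠ c, ρ c x • b c x (s x) (t x) := by
      funext x
      rw [hh, ← ρ.sum_finsupport_smul_eq_finsum (A := ℂ) x (fun c x => b c x (s x) (t x))]
      rfl
    rw [heq]
    intro x hx
    refine (ρ.contMDiffAt_finsum fun c hc => ?_).contMDiffWithinAt
    have hxc : x ∈ (e c).baseSet := hρ c hc
    have hO : IsOpen (U ∩ (e c).baseSet) := hU.inter (e c).open_baseSet
    have aux : ∀ σ : ∀ x, V.Fiber x, V.IsHolOn U σ →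
        ContMDiffAt 𝓘(ℝ, ℂ) 𝓘(ℝ, F) ∞ (fun y => (e c).linearMapAt ℂ y (σ y)) x := by
      intro σ hσ
      have h1 : ContMDiffOn 𝓘(ℂ) 𝓘(ℂ, F) ω (fun y => ((e c) ⟨y, σ y⟩).2)
          (U ∩ (e c).baseSet) :=
        (((e c).contMDiffOn_section_iff (IB := 𝓘(ℂ)) (n := ω) hO
          inter_subset_right).1 (hσ.mono inter_subset_left))
      have h2 := (contMDiffOn_real_of_complex h1).contMDiffAt
        (hO.mem_nhds ⟨hx, hxc⟩)
      refine h2.congr_of_eventuallyEq ?_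
      filter_upwards [(e c).open_baseSet.mem_nhds hxc] with y hy
      rw [Trivialization.linearMapAt_apply, if_pos hy]
    have hi : ContDiff ℝ ∞ (fun p : F × F => (inner ℂ p.1 p.2 : ℂ)) := contDiff_inner
    exact hi.contMDiff.contMDiffAt.comp x ((aux s hs).prodMk_space (aux t ht))

/-- A chosen smooth Hermitian metric on `V`; the degree below does not depend on it. -/
def metric [T2Space X] [CompactSpace X] : V.HermitianMetric :=
  Classical.choice V.nonempty_hermitianMetric

end HolVB

/-- A chosen smooth partition of unity on a compact Riemann surface, the function of index `c`
being supported in the source of the chart at `c`. -/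
def chartPartition (X : Type u) [TopologicalSpace X] [ChartedSpace ℂ X] [IsManifold 𝓘(ℂ) ω X]
    [T2Space X] [CompactSpace X] : SmoothPartitionOfUnity X 𝓘(ℝ, ℂ) X univ :=
  have := isManifold_real_of_complex X
  (SmoothPartitionOfUnity.exists_isSubordinate_chartAt_source 𝓘(ℝ, ℂ) X).choose

theorem chartPartition_isSubordinate (X : Type u) [TopologicalSpace X] [ChartedSpace ℂ X]
    [IsManifold 𝓘(ℂ) ω X] [T2Space X] [CompactSpace X] :
    (chartPartition X).IsSubordinate fun x => (chartAt ℂ x).source :=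
  have := isManifold_real_of_complex X
  (SmoothPartitionOfUnity.exists_isSubordinate_chartAt_source 𝓘(ℝ, ℂ) X).choose_spec

/-- The integral over `X` of the real two-form which is `η c z dx ∧ dy` in the chart at `c`. -/
def integralTwoForm [T2Space X] [CompactSpace X] (η : X → ℂ → ℝ) : ℝ :=
  ∑ᶠ c : X, ∫ z in (chartAt ℂ c).target,
    chartPartition X c ((chartAt ℂ c).symm z) * η c z

namespace HolVB

variable {r : ℕ} {V : HolVB.{u, v} X r}

/-- A holomorphic frame of the subbundle `S` on a neighbourhood of `x`. -/
def Sub.frame (S : V.Sub) (x : X) : Fin S.rank → ∀ y, V.Fiber y :=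
  (S.exists_frame x).choose_spec.2.2.choose

/-- `log det (h(sᵢ, sⱼ))`. -/
def HermitianMetric.logGram (h : V.HermitianMetric) {k : ℕ} (s : Fin k → ∀ y, V.Fiber y)
    (x : X) : ℝ :=
  Real.log (Matrix.det (Matrix.of fun i j => h.form x (s i x) (s j x))).re

/-- The density, in the chart at `c`, of the first Chern form `(i / 2π) tr F` of the Chern
connection of the restriction of `h` to `S`. In a local holomorphic frame `s` this form is
`-(i / 2π) ∂ ∂̄ log det (h(sᵢ, sⱼ)) = -(1 / 4π) Δ log det (h(sᵢ, sⱼ)) dx ∧ dy`. -/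
def Sub.chernDensity (S : V.Sub) (h : V.HermitianMetric) (c : X) (z : ℂ) : ℝ :=
  -(1 / (4 * Real.pi)) * Laplacian.laplacian
    (fun w : ℂ => h.logGram (S.frame ((chartAt ℂ c).symm z)) ((chartAt ℂ c).symm w)) z

/-- The degree of a subbundle, as the integral of its first Chern form. -/
def Sub.degree [T2Space X] [CompactSpace X] (S : V.Sub) : ℝ :=
  integralTwoForm (S.chernDensity V.metric)

variable (V)

def degree [T2Space X] [CompactSpace X] : ℝ := V.top.degree

/-- The slope `μ(V)`. -/
def slope [T2Space X] [CompactSpace X] : ℝ := V.degree / r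

/-- `t` restricts to a holomorphic section over the open set `U` of `V ⊗ L`, for a line bundle
`L`: locally, `t = s ⊗ l` for holomorphic sections `s` of `V` and `l` of `L`. -/
def IsHolTensorOn (L : HolVB.{u, v₃} X 1) (U : Set X)
    (t : ∀ x, V.Fiber x ⊗[ℂ] L.Fiber x) : Prop :=
  ∀ x ∈ U, ∃ U' : Set X, IsOpen U' ∧ x ∈ U' ∧ U' ⊆ U ∧
    ∃ (s : ∀ y, V.Fiber y) (l : ∀ y, L.Fiber y), V.IsHolOn U' s ∧ L.IsHolOn U' l ∧
      ∀ y ∈ U', t y = s y ⊗ₜ[ℂ] l y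

end HolVB

/-- A holomorphic bundle map `V → W ⊗ L`. -/
structure TwistedMap {r r' : ℕ} (V : HolVB.{u, v₁} X r) (W : HolVB.{u, v₂} X r')
    (L : HolVB.{u, v₃} X 1) where
  toFun : ∀ x, V.Fiber x →ₗ[ℂ] W.Fiber x ⊗[ℂ] L.Fiber x
  holomorphic : ∀ (U : Set X) (s : ∀ x, V.Fiber x), IsOpen U → V.IsHolOn U s →
    W.IsHolTensorOn L U (fun x => toFun x (s x))

namespace TwistedMap

variable {r r' : ℕ} {V : HolVB.{u, v₁} X r} {W : HolVB.{u, v₂} X r'} {L : HolVB.{u, v₃} X 1}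

/-- The rank of the kernel sheaf. On a connected Riemann surface the dimension of the kernel on
fibres takes its minimal value outside a discrete set, and this value is the generic rank. -/
def kerRank (f : TwistedMap V W L) : ℕ :=
  ⨅ x : X, Module.finrank ℂ (LinearMap.ker (f.toFun x))

/-- Injectivity as a morphism of sheaves of holomorphic sections. -/
def Injective (f : TwistedMap V W L) : Prop :=
  ∀ (U : Set X) (s : ∀ x, V.Fiber x), IsOpen U → V.IsHolOn U s →
    (∀ x ∈ U, f.toFun x (s x) = 0) → ∀ x ∈ U, s x = 0

def IsZero (f : TwistedMap V W L) : Prop := ∀ x, f.toFun x = 0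

/-- `f` maps the subbundle `S` to `T ⊗ L`. -/
def MapsTo (f : TwistedMap V W L) (S : V.Sub) (T : W.Sub) : Prop :=
  ∀ x, ∀ v ∈ S.carrier x,
    f.toFun x v ∈ LinearMap.range ((T.carrier x).subtype.rTensor (L.Fiber x))

end TwistedMap

/-- An `L`-twisted `U(p,q)`-Higgs bundle `(V, W, β, γ)`. -/
structure TwistedHiggs (p q : ℕ) (L : HolVB.{u, v₃} X 1) where
  V : HolVB.{u, v₁} X p
  W : HolVB.{u, v₂} X q
  β : TwistedMap W V L
  γ : TwistedMap V W L

namespace TwistedHiggs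

variable {p q : ℕ} {L : HolVB.{u, v₃} X 1}

/-- The subbundles `V'` of `V` and `W'` of `W` form a subobject. -/
def IsSubobject (E : TwistedHiggs.{u, v₁, v₂, v₃} p q L) (V' : E.V.Sub) (W' : E.W.Sub) : Prop :=
  E.β.MapsTo W' V' ∧ E.γ.MapsTo V' W'

variable [T2Space X] [CompactSpace X]

/-- The `α`-slope of `(V', W')`, namely `μ(V' ⊕ W') + α p' / (p' + q')`. -/
def subSlope (E : TwistedHiggs.{u, v₁, v₂, v₃} p q L) (α : ℝ) (V' : E.V.Sub) (W' : E.W.Sub) : ℝ :=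
  (V'.degree + W'.degree) / (V'.rank + W'.rank) + α * (V'.rank / (V'.rank + W'.rank))

/-- The `α`-slope of `E`. -/
def slope (E : TwistedHiggs.{u, v₁, v₂, v₃} p q L) (α : ℝ) : ℝ :=
  E.subSlope α E.V.top E.W.top

/-- `α`-semistability: `μ_α(F) ≤ μ_α(E)` for each subobject `F` other than `0` and `E`. -/
def IsSemistable (E : TwistedHiggs.{u, v₁, v₂, v₃} p q L) (α : ℝ) : Prop :=
  ∀ (V' : E.V.Sub) (W' : E.W.Sub), E.IsSubobject V' W' →
    ¬ (V'.rank = 0 ∧ W'.rank = 0) → ¬ (V'.rank = p ∧ W'.rank = q) →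
      E.subSlope α V' W' ≤ E.slope α

/-- The threshold `αᵢ`. -/
def threshold (E : TwistedHiggs.{u, v₁, v₂, v₃} p q L) (i : ℤ) : ℝ :=
  2 * p * q / (q * (p - q) + (i + 1) * (p + q)) * (E.W.slope - E.V.slope - L.degree) + L.degree

/-- The threshold `α'ⱼ`. -/
def threshold' (E : TwistedHiggs.{u, v₁, v₂, v₃} p q L) (j : ℤ) : ℝ :=
  2 * p * q / (p * (q - p) + (j + 1) * (p + q)) * (E.W.slope - E.V.slope + L.degree) - L.degree

end TwistedHiggs

end

/-! Everything about β follows from one inequality, `IsSemistable.kerRank_inequality`; the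
statements about γ are obtained from it by exchanging V with W and α with -α.

Let n = rk(ker β), let K ⊂ W be the kernel, and let I ⊂ V be the saturation of the image of β,
untwisted by L, of rank q - n. Both (0, K) and (I, W) are subobjects. With μ the α-slope of E,
semistability gives deg K ≤ nμ and deg I + deg W + α(q - n) ≤ (2q - n)μ. The map W/K → I ⊗ L induced
by β is generically an isomorphism, so deg W ≤ deg K + deg I + (q - n) deg L. Adding the three and
multiplying by p + q yields 2pq(μ(W) - μ(V) - deg L) ≤ (α - deg L)(q(p - q) + n(p + q)). The last
factor increases with n and, for n = i, is the denominator of the threshold of index i - 1. Hence α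
below that threshold bounds n from above or from below according to the sign of the left side.

The substance is the degree inequality `TwistedMap.degree_le`, because degrees are integrals of
Chern forms. Locally, germs of holomorphic functions form a discrete valuation ring, and the Smith
normal form gives frames in which a twisted map is diagonal with monomial entries
(`nonempty_localForm`). These frames exhibit the kernel and the saturated image as subbundles.

Globally, the squared norm of the determinant of the induced map from the quotient by the kernel to
the saturated image twisted by L is a smooth function φ ≥ 0 with finitely many zeros (`normFun`).
Off the zeros, Δ log φ is a combination of Chern densities (`laplacian_log_normFun`). Zeros are
handled by regularization: Δ log(φ + ε) has integral 0 by Stokes and dominates φ/(φ + ε) · Δ log φ;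
letting ε → 0 gives the sign of the total integral (`integralTwoForm_laplacian_log_nonpos`) without
any count of multiplicities. -/

set_option linter.unusedSectionVars false

/-! ### Calculus in the plane: logarithmic Laplacians, Green's identity, conformal invariance. -/

noncomputable section

open Filter Topology Complex

/-- The Euclidean inner product of the gradients of two functions on the plane. -/
def gradDot (a b : ℂ → ℝ) (z : ℂ) : ℝ :=
  fderiv ℝ a z 1 * fderiv ℝ b z 1 + fderiv ℝ a z I * fderiv ℝ b z I

theorem fderiv_fderiv_apply {f : ℂ → ℝ} {z : ℂ} (hf : ContDiffAt ℝ 2 f z) (v w : ℂ) :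
    fderiv ℝ (fderiv ℝ f) z v w = fderiv ℝ (fun y => fderiv ℝ f y w) z v := by
  have h : DifferentiableAt ℝ (fderiv ℝ f) z :=
    (hf.fderiv_right (m := 1) (by norm_num)).differentiableAt (by norm_num)
  rw [fderiv_clm_apply h (differentiableAt_const w)]
  simp

theorem laplacian_eq_fderiv {f : ℂ → ℝ} {z : ℂ} (hf : ContDiffAt ℝ 2 f z) :
    Laplacian.laplacian f z =
      fderiv ℝ (fun y => fderiv ℝ f y 1) z 1 + fderiv ℝ (fun y => fderiv ℝ f y I) z I := by
  rw [InnerProductSpace.laplacian_eq_iteratedFDeriv_complexPlane]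
  simp [iteratedFDeriv_two_apply, fderiv_fderiv_apply hf]

/-- The quotient rule applied twice. The shift ε allows the same formula to serve for log Φ and for
its regularization, which stays smooth at the zeros of Φ. -/
theorem laplacian_log_add {Φ : ℂ → ℝ} {z : ℂ} {ε : ℝ} (hΦ : ContDiffAt ℝ 2 Φ z)
    (hpos : 0 < Φ z + ε) :
    Laplacian.laplacian (fun w => Real.log (Φ w + ε)) z =
      Laplacian.laplacian Φ z / (Φ z + ε) - gradDot Φ Φ z / (Φ z + ε) ^ 2 := by
  have hne : Φ z + ε ≠ 0 := hpos.ne'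
  have hΦε : ContDiffAt ℝ 2 (fun w => Φ w + ε) z := hΦ.add contDiffAt_const
  rw [laplacian_eq_fderiv (hΦε.log hne), laplacian_eq_fderiv hΦ]
  have hev : ∀ᶠ w in 𝓝 z, ContDiffAt ℝ 2 Φ w ∧ Φ w + ε ≠ 0 :=
    (hΦ.eventually (by simp)).and (hΦε.continuousAt.eventually_ne hne)
  have key : ∀ v : ℂ, fderiv ℝ (fun y => fderiv ℝ (fun w => Real.log (Φ w + ε)) y v) z v =
      fderiv ℝ (fun y => fderiv ℝ Φ y v) z v / (Φ z + ε) -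
        (fderiv ℝ Φ z v * fderiv ℝ Φ z v) / (Φ z + ε) ^ 2 := by
    intro v
    have h1 : (fun y => fderiv ℝ (fun w => Real.log (Φ w + ε)) y v) =ᶠ[𝓝 z]
        fun y => fderiv ℝ Φ y v * (Φ y + ε)⁻¹ := by
      filter_upwards [hev] with y hy
      have hd : DifferentiableAt ℝ Φ y := hy.1.differentiableAt (by norm_num)
      rw [fderiv.log (hd.add_const ε) hy.2, fderiv_add_const]
      simp [mul_comm]
    rw [h1.fderiv_eq]
    have hd : HasFDerivAt Φ (fderiv ℝ Φ z) z :=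
      (hΦ.differentiableAt (by norm_num)).hasFDerivAt
    have hd2 : DifferentiableAt ℝ (fun y => fderiv ℝ Φ y v) z :=
      ((hΦ.fderiv_right (m := 1) (by norm_num)).differentiableAt (by norm_num)).clm_apply
        (differentiableAt_const v)
    have hinv := (hasDerivAt_inv hne).comp_hasFDerivAt z (hd.add_const ε)
    have := (hd2.hasFDerivAt.mul hinv).fderiv
    simp only [Function.comp_def] at this
    erw [this]
    simp
    field_simp
    ring
  rw [key, key, gradDot]
  ring

/-- The two sides differ by ε|∇Φ|² / (Φ(Φ + ε)²) ≥ 0. This is the source of the sign in the degree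
inequality. -/
theorem laplacian_log_add_ge {Φ : ℂ → ℝ} {z : ℂ} {ε : ℝ} (hΦ : ContDiffAt ℝ 2 Φ z)
    (hpos : 0 < Φ z) (hε : 0 ≤ ε) :
    Φ z / (Φ z + ε) * Laplacian.laplacian (fun w => Real.log (Φ w)) z ≤
      Laplacian.laplacian (fun w => Real.log (Φ w + ε)) z := by
  have h0 := laplacian_log_add (ε := 0) hΦ (by simpa using hpos)
  simp only [add_zero] at h0
  rw [laplacian_log_add hΦ (by positivity), h0]
  have hg : 0 ≤ gradDot Φ Φ z := by
    rw [gradDot]; nlinarith [sq_nonneg (fderiv ℝ Φ z 1), sq_nonneg (fderiv ℝ Φ z I)]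
  have : Laplacian.laplacian Φ z / (Φ z + ε) - gradDot Φ Φ z / (Φ z + ε) ^ 2 -
      Φ z / (Φ z + ε) * (Laplacian.laplacian Φ z / Φ z - gradDot Φ Φ z / Φ z ^ 2) =
      gradDot Φ Φ z * ε / (Φ z * (Φ z + ε) ^ 2) := by
    field_simp
    ring
  have h2 : 0 ≤ gradDot Φ Φ z * ε / (Φ z * (Φ z + ε) ^ 2) := by positivity
  linarith

/-- Products of a compactly supported continuous function and one which is continuous near the
support are integrable. -/
theorem integrable_mul_of_tsupport {Ω : Set ℂ} (hΩ : IsOpen Ω) {a b : ℂ → ℝ}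
    (ha : Continuous a) (hc : HasCompactSupport a) (hsub : tsupport a ⊆ Ω)
    (hb : ContinuousOn b Ω) : Integrable (fun z => a z * b z) := by
  have hcont : Continuous (fun z => a z * b z) := by
    refine continuous_of_tsupport fun z hz => ?_
    have hzΩ : z ∈ Ω := hsub (tsupport_mul_subset_left hz)
    exact ha.continuousAt.mul (hb.continuousAt (hΩ.mem_nhds hzΩ))
  exact hcont.integrable_of_hasCompactSupport hc.mul_right

/-- Green's first identity, by parts in the directions 1 and I. Since a has compact support inside
Ω, there is no boundary term and the behaviour of f outside Ω is irrelevant. -/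
theorem integral_mul_laplacian {Ω : Set ℂ} (hΩ : IsOpen Ω) {a f : ℂ → ℝ}
    (ha : ContDiff ℝ 1 a) (hc : HasCompactSupport a) (hsub : tsupport a ⊆ Ω)
    (hf : ContDiffOn ℝ 2 f Ω) :
    ∫ z in Ω, a z * Laplacian.laplacian f z = - ∫ z in Ω, gradDot a f z := by
  have hfat : ∀ z ∈ Ω, ContDiffAt ℝ 2 f z := fun z hz => hf.contDiffAt (hΩ.mem_nhds hz)
  have hz0 : ∀ z, z ∉ Ω → a z = 0 := fun z hz => image_eq_zero_of_notMem_tsupport (hz <| hsub ·)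
  have hz1 : ∀ z, z ∉ Ω → fderiv ℝ a z = 0 := fun z hz =>
    image_eq_zero_of_notMem_tsupport (fun h => hz (hsub (tsupport_fderiv_subset ℝ h)))
  rw [setIntegral_eq_integral_of_forall_compl_eq_zero (fun z hz => by simp [hz0 z hz]),
    setIntegral_eq_integral_of_forall_compl_eq_zero (fun z hz => by simp [gradDot, hz1 z hz])]
  have hdv : ∀ v, ContDiffOn ℝ 1 (fun y => fderiv ℝ f y v) Ω := fun v z hz =>
    (((hfat z hz).fderiv_right (m := 1) (by norm_num)).clm_apply
      contDiffAt_const).contDiffWithinAt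
  have hda : ∀ v, Continuous (fun y => fderiv ℝ a y v) := fun v =>
    (ha.continuous_fderiv (by norm_num)).clm_apply continuous_const
  have hsubd : ∀ v, tsupport (fun y => fderiv ℝ a y v) ⊆ Ω := fun v =>
    (closure_mono (fun y hy => by
      simp only [Function.mem_support] at hy ⊢
      exact fun h => hy (by simp [h]))).trans ((tsupport_fderiv_subset ℝ).trans hsub)
  have hI1 : ∀ v, Integrable (fun y => fderiv ℝ a y v * fderiv ℝ f y v) := fun v =>
    integrable_mul_of_tsupport hΩ (hda v) (hc.fderiv_apply ℝ v) (hsubd v) (hdv v).continuousOn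
  have hI2 : ∀ v, Integrable (fun y => a y * fderiv ℝ (fun w => fderiv ℝ f w v) y v) := fun v =>
    integrable_mul_of_tsupport hΩ ha.continuous hc hsub (fun z hz =>
      (((((hdv v).contDiffAt (hΩ.mem_nhds hz)).fderiv_right (m := 0) (by norm_num)).clm_apply
        contDiffAt_const).continuousAt).continuousWithinAt)
  have hI3 : ∀ v, Integrable (fun y => a y * fderiv ℝ f y v) := fun v =>
    integrable_mul_of_tsupport hΩ ha.continuous hc hsub (hdv v).continuousOn
  have parts : ∀ v, ∫ y, a y * fderiv ℝ (fun w => fderiv ℝ f w v) y v =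
      - ∫ y, fderiv ℝ a y v * fderiv ℝ f y v := fun v =>
    integral_mul_fderiv_eq_neg_fderiv_mul_of_integrable (hI1 v) (hI2 v) (hI3 v)
      (fun x _ => ha.differentiable (by norm_num) x)
      (fun x hx => ((hdv v).contDiffAt (hΩ.mem_nhds (hsub hx))).differentiableAt (by norm_num))
  have e1 : (fun z => a z * Laplacian.laplacian f z) = fun z =>
      a z * fderiv ℝ (fun w => fderiv ℝ f w 1) z 1 +
      a z * fderiv ℝ (fun w => fderiv ℝ f w I) z I := by
    funext z
    by_cases hz : z ∈ Ω
    · rw [laplacian_eq_fderiv (hfat z hz)]; ring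
    · simp [hz0 z hz]
  rw [e1, integral_add (hI2 1) (hI2 I), parts, parts]
  simp only [gradDot]
  rw [integral_add (hI1 1) (hI1 I)]
  ring

/-- Conformal invariance of the Dirichlet density. -/
theorem gradDot_comp {τ : ℂ → ℂ} {τ' z : ℂ} (hτ : HasDerivAt τ τ' z) {a b : ℂ → ℝ}
    (ha : DifferentiableAt ℝ a (τ z)) (hb : DifferentiableAt ℝ b (τ z)) :
    gradDot (a ∘ τ) (b ∘ τ) z = normSq τ' * gradDot a b (τ z) := by
  have h : HasFDerivAt τ ((ContinuousLinearMap.toSpanSingleton ℂ τ').restrictScalars ℝ) z :=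
    hτ.hasFDerivAt.restrictScalars ℝ
  rw [gradDot, (ha.hasFDerivAt.comp z h).fderiv, (hb.hasFDerivAt.comp z h).fderiv, gradDot]
  -- The real derivative of τ sends 1 to τ' and I to Iτ', two orthogonal vectors of equal length
  -- |τ'|; expanding in the basis 1, I then makes the cross terms cancel.
  have e : ∀ (T : ℂ →L[ℝ] ℝ) (w : ℂ), T w = w.re * T 1 + w.im * T I := by
    intro T w
    conv_lhs => rw [← re_add_im w]
    have h1 : ((w.re : ℂ)) = w.re • (1 : ℂ) := by simp
    have h2 : ((w.im : ℂ)) * I = w.im • I := by simp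
    rw [map_add, h1, h2, map_smul, map_smul]; simp
  simp only [ContinuousLinearMap.comp_apply, ContinuousLinearMap.coe_restrictScalars',
    ContinuousLinearMap.toSpanSingleton_apply, smul_eq_mul, one_mul]
  rw [e (fderiv ℝ a (τ z)) τ', e (fderiv ℝ b (τ z)) τ', e (fderiv ℝ a (τ z)) (I * τ'),
    e (fderiv ℝ b (τ z)) (I * τ')]
  simp [normSq_apply]
  ring

theorem det_toSpanSingleton_restrictScalars (w : ℂ) :
    ((ContinuousLinearMap.toSpanSingleton ℂ w).restrictScalars ℝ).det = normSq w := by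
  rw [ContinuousLinearMap.det, ← LinearMap.det_toMatrix Complex.basisOneI, Matrix.det_fin_two]
  simp [LinearMap.toMatrix_apply, normSq_apply]

/-- The Jacobian |τ'|² of the change of variables is exactly the conformal factor of `gradDot_comp`.
-/
theorem integral_gradDot_image {A : Set ℂ} (hA : IsOpen A) {τ : ℂ → ℂ}
    (hτ : DifferentiableOn ℂ τ A) (hinj : InjOn τ A) {a b : ℂ → ℝ}
    (ha : ∀ z ∈ A, DifferentiableAt ℝ a (τ z)) (hb : ∀ z ∈ A, DifferentiableAt ℝ b (τ z)) :
    ∫ z in τ '' A, gradDot a b z = ∫ z in A, gradDot (a ∘ τ) (b ∘ τ) z := by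
  have hd : ∀ z ∈ A, HasDerivAt τ (deriv τ z) z := fun z hz =>
    (hτ.differentiableAt (hA.mem_nhds hz)).hasDerivAt
  rw [integral_image_eq_integral_abs_det_fderiv_smul volume hA.measurableSet
    (fun z hz => ((hd z hz).hasFDerivAt.restrictScalars ℝ).hasFDerivWithinAt) hinj]
  refine setIntegral_congr_fun hA.measurableSet fun z hz => ?_
  rw [gradDot_comp (hd z hz) (ha z hz) (hb z hz), smul_eq_mul]
  congr 1
  erw [det_toSpanSingleton_restrictScalars]
  exact abs_of_nonneg (normSq_nonneg _)

end

/-! ### Stokes' theorem on a compact Riemann surface. -/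

noncomputable section

variable {X : Type u} [TopologicalSpace X] [ChartedSpace ℂ X] [IsManifold 𝓘(ℂ) ω X]
open Filter Topology Complex

theorem ContMDiffAt.contDiffAt_comp_chart_symm {F : Type*} [NormedAddCommGroup F]
    [NormedSpace ℝ F] {f : X → F} {x : X}
    (hf : ContMDiffAt 𝓘(ℝ, ℂ) 𝓘(ℝ, F) ∞ f x) {c : X} (hx : x ∈ (chartAt ℂ c).source) :
    ContDiffAt ℝ ∞ (fun z => f ((chartAt ℂ c).symm z)) (chartAt ℂ c x) := by
  have := isManifold_real_of_complex X
  have h1 := contMDiffAt_symm_of_mem_maximalAtlas (I := 𝓘(ℝ, ℂ)) (n := ∞)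
    (IsManifold.chart_mem_maximalAtlas c) ((chartAt ℂ c).map_source hx)
  refine contMDiffAt_iff_contDiffAt.1 (ContMDiffAt.comp _ (g := f) ?_ h1)
  rwa [(chartAt ℂ c).left_inv hx]

theorem ContMDiffAt.analyticAt_comp_chart_symm {F : Type*} [NormedAddCommGroup F]
    [NormedSpace ℂ F] [CompleteSpace F] {f : X → F} {x : X}
    (hf : ContMDiffAt 𝓘(ℂ) 𝓘(ℂ, F) ω f x) {c : X} (hx : x ∈ (chartAt ℂ c).source) :
    AnalyticAt ℂ (fun z => f ((chartAt ℂ c).symm z)) (chartAt ℂ c x) := by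
  have h1 := contMDiffAt_symm_of_mem_maximalAtlas (I := 𝓘(ℂ)) (n := ω)
    (IsManifold.chart_mem_maximalAtlas c) ((chartAt ℂ c).map_source hx)
  refine (contMDiffAt_iff_contDiffAt.1 (ContMDiffAt.comp _ (g := f) ?_ h1)).analyticAt
  rwa [(chartAt ℂ c).left_inv hx]

theorem gradDot_congr {a a' b b' : ℂ → ℝ} {z : ℂ} (ha : a =ᶠ[𝓝 z] a') (hb : b =ᶠ[𝓝 z] b') :
    gradDot a b z = gradDot a' b' z := by
  rw [gradDot, gradDot, ha.fderiv_eq, hb.fderiv_eq]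

theorem gradDot_comm (a b : ℂ → ℝ) (z : ℂ) : gradDot a b z = gradDot b a z := by
  simp only [gradDot]; ring

theorem gradDot_sum_right {ι : Type*} (D : Finset ι) {a : ℂ → ℝ} {b : ι → ℂ → ℝ} {z : ℂ}
    (hb : ∀ d ∈ D, DifferentiableAt ℝ (b d) z) :
    gradDot a (fun w => ∑ d ∈ D, b d w) z = ∑ d ∈ D, gradDot a (b d) z := by
  simp only [gradDot]
  rw [fderiv_fun_sum hb, sum_apply, sum_apply,
    Finset.mul_sum, Finset.mul_sum, Finset.sum_add_distrib]

theorem gradDot_eq_zero_of_eventuallyEq_zero {a b : ℂ → ℝ} {z : ℂ} (ha : a =ᶠ[𝓝 z] 0) :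
    gradDot a b z = 0 := by
  have : fderiv ℝ a z = 0 := by rw [ha.fderiv_eq]; exact fderiv_const_apply 0
  simp [gradDot, this]

theorem eventually_comp_chart_symm {p : X → Prop} {c : X} {z : ℂ}
    (hz : z ∈ (chartAt ℂ c).target) (h : ∀ᶠ y in 𝓝 ((chartAt ℂ c).symm z), p y) :
    ∀ᶠ w in 𝓝 z, p ((chartAt ℂ c).symm w) :=
  ((chartAt ℂ c).continuousAt_symm hz).eventually h

/-- A function supported in the source of a chart, transported to the plane. -/
def chartPush (c : X) (g : X → ℝ) : ℂ → ℝ :=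
  (chartAt ℂ c).target.indicator fun z => g ((chartAt ℂ c).symm z)

theorem chartPush_eventuallyEq (c : X) (g : X → ℝ) {z : ℂ} (hz : z ∈ (chartAt ℂ c).target) :
    chartPush c g =ᶠ[𝓝 z] fun w => g ((chartAt ℂ c).symm w) := by
  filter_upwards [(chartAt ℂ c).open_target.mem_nhds hz] with w hw
  exact indicator_of_mem hw _

section

variable [T2Space X] [CompactSpace X]

theorem tsupport_chartPush (c : X) {g : X → ℝ} (hg : tsupport g ⊆ (chartAt ℂ c).source) :
    HasCompactSupport (chartPush c g) ∧ tsupport (chartPush c g) ⊆ (chartAt ℂ c).target := by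
  have hK : IsCompact (chartAt ℂ c '' tsupport g) :=
    (isClosed_tsupport g).isCompact.image_of_continuousOn
      ((chartAt ℂ c).continuousOn.mono hg)
  have hs : Function.support (chartPush c g) ⊆ chartAt ℂ c '' tsupport g := by
    intro z hz
    have hzT : z ∈ (chartAt ℂ c).target := by
      by_contra h; exact hz (indicator_of_notMem h _)
    refine ⟨(chartAt ℂ c).symm z, subset_tsupport _ ?_, (chartAt ℂ c).right_inv hzT⟩
    rwa [Function.mem_support, chartPush, indicator_of_mem hzT] at hz
  have ht : tsupport (chartPush c g) ⊆ chartAt ℂ c '' tsupport g :=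
    closure_minimal hs hK.isClosed
  refine ⟨hK.of_isClosed_subset (isClosed_tsupport _) ht, ht.trans ?_⟩
  rintro _ ⟨x, hx, rfl⟩
  exact (chartAt ℂ c).map_source (hg hx)

theorem contDiffAt_chart_of_contMDiff {f : X → ℝ} (hf : ContMDiff 𝓘(ℝ, ℂ) 𝓘(ℝ, ℝ) ∞ f) {c : X}
    {z : ℂ} (hz : z ∈ (chartAt ℂ c).target) :
    ContDiffAt ℝ ∞ (fun w => f ((chartAt ℂ c).symm w)) z := by
  have := (hf ((chartAt ℂ c).symm z)).contDiffAt_comp_chart_symm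
    ((chartAt ℂ c).map_target hz)
  rwa [(chartAt ℂ c).right_inv hz] at this

theorem contDiff_chartPush {c : X} {g : X → ℝ} (hg : ContMDiff 𝓘(ℝ, ℂ) 𝓘(ℝ, ℝ) ∞ g)
    (hs : tsupport g ⊆ (chartAt ℂ c).source) : ContDiff ℝ ∞ (chartPush c g) := by
  rw [contDiff_iff_contDiffAt]
  intro z
  by_cases hz : z ∈ tsupport (chartPush c g)
  · have hzT := (tsupport_chartPush c hs).2 hz
    exact (contDiffAt_chart_of_contMDiff hg hzT).congr_of_eventuallyEq
      (chartPush_eventuallyEq c g hzT)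
  · exact contDiffAt_const.congr_of_eventuallyEq (notMem_tsupport_iff_eventuallyEq.1 hz)

theorem integral_chart_mul_laplacian {c : X} {g f : X → ℝ}
    (hg : ContMDiff 𝓘(ℝ, ℂ) 𝓘(ℝ, ℝ) ∞ g) (hf : ContMDiff 𝓘(ℝ, ℂ) 𝓘(ℝ, ℝ) ∞ f)
    (hs : tsupport g ⊆ (chartAt ℂ c).source) :
    ∫ z in (chartAt ℂ c).target, g ((chartAt ℂ c).symm z) *
        Laplacian.laplacian (fun w => f ((chartAt ℂ c).symm w)) z =
      - ∫ z in (chartAt ℂ c).target, gradDot (fun w => g ((chartAt ℂ c).symm w))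
        (fun w => f ((chartAt ℂ c).symm w)) z := by
  have hO := (chartAt ℂ c).open_target
  have h := integral_mul_laplacian hO ((contDiff_chartPush hg hs).of_le (by simp))
    (tsupport_chartPush c hs).1 (tsupport_chartPush c hs).2
    (f := fun w => f ((chartAt ℂ c).symm w))
    (fun z hz => ((contDiffAt_chart_of_contMDiff hf hz).of_le (WithTop.coe_le_coe.2 (le_top : (2 : ℕ∞) ≤ ⊤))).contDiffWithinAt)
  rw [setIntegral_congr_fun hO.measurableSet (fun z hz => by
      exact congrArg (· * _) (chartPush_eventuallyEq c g hz).eq_of_nhds),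
    setIntegral_congr_fun hO.measurableSet (fun z hz =>
      gradDot_congr (chartPush_eventuallyEq c g hz) EventuallyEq.rfl)] at h
  exact h

theorem integrableOn_chart_gradDot {c : X} {g f : X → ℝ}
    (hg : ContMDiff 𝓘(ℝ, ℂ) 𝓘(ℝ, ℝ) ∞ g) (hf : ContMDiff 𝓘(ℝ, ℂ) 𝓘(ℝ, ℝ) ∞ f)
    (hs : tsupport g ⊆ (chartAt ℂ c).source) :
    IntegrableOn (fun z => gradDot (fun w => g ((chartAt ℂ c).symm w))
        (fun w => f ((chartAt ℂ c).symm w)) z) (chartAt ℂ c).target := by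
  have hO := (chartAt ℂ c).open_target
  have hP := contDiff_chartPush hg hs
  obtain ⟨hc, ht⟩ := tsupport_chartPush c hs
  have hI : ∀ v, Integrable (fun z => fderiv ℝ (chartPush c g) z v *
      fderiv ℝ (fun w => f ((chartAt ℂ c).symm w)) z v) := by
    intro v
    refine integrable_mul_of_tsupport hO ((hP.continuous_fderiv (by simp)).clm_apply
      continuous_const) (hc.fderiv_apply ℝ v) ?_ ?_
    · exact (closure_mono (fun y hy => by
        simp only [Function.mem_support] at hy ⊢
        exact fun h => hy (by simp [h]))).trans ((tsupport_fderiv_subset ℝ).trans ht)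
    · intro z hz
      exact ((((contDiffAt_chart_of_contMDiff hf hz).fderiv_right (m := 0) (by simp)).clm_apply
        contDiffAt_const).continuousAt).continuousWithinAt
  refine (((hI 1).add (hI I)).integrableOn (s := (chartAt ℂ c).target)).congr_fun (fun z hz => ?_)
    hO.measurableSet
  exact gradDot_congr (chartPush_eventuallyEq c g hz) EventuallyEq.rfl

theorem comp_chart_symm_eventuallyEq_zero {c : X} {g : X → ℝ} {z : ℂ}
    (hz : z ∈ (chartAt ℂ c).target) (h : (chartAt ℂ c).symm z ∉ tsupport g) :
    (fun w => g ((chartAt ℂ c).symm w)) =ᶠ[𝓝 z] 0 :=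
  eventually_comp_chart_symm hz (notMem_tsupport_iff_eventuallyEq.1 h)

/-- Off the overlap of the two charts one of the functions vanishes near the point, so both
integrals live on the overlap. There the transition map is holomorphic and injective, and the
Dirichlet integral is conformally invariant. -/
theorem integral_chart_gradDot_eq {c d : X} {g f : X → ℝ}
    (hg : ContMDiff 𝓘(ℝ, ℂ) 𝓘(ℝ, ℝ) ∞ g) (hf : ContMDiff 𝓘(ℝ, ℂ) 𝓘(ℝ, ℝ) ∞ f)
    (hgs : tsupport g ⊆ (chartAt ℂ c).source) (hfs : tsupport f ⊆ (chartAt ℂ d).source) :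
    ∫ z in (chartAt ℂ c).target, gradDot (fun w => g ((chartAt ℂ c).symm w))
        (fun w => f ((chartAt ℂ c).symm w)) z =
      ∫ z in (chartAt ℂ d).target, gradDot (fun w => g ((chartAt ℂ d).symm w))
        (fun w => f ((chartAt ℂ d).symm w)) z := by
  set φ := chartAt ℂ c with hφ
  set ψ := chartAt ℂ d with hψ
  set τ : ℂ → ℂ := fun z => ψ (φ.symm z) with hτdef
  set A : Set ℂ := φ.target ∩ φ.symm ⁻¹' ψ.source with hAdef
  set B : Set ℂ := ψ.target ∩ ψ.symm ⁻¹' φ.source with hBdef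
  have hA : IsOpen A := φ.isOpen_inter_preimage_symm ψ.open_source
  have hB : IsOpen B := ψ.isOpen_inter_preimage_symm φ.open_source
  have hinv : ∀ z ∈ A, φ.symm z = ψ.symm (τ z) := fun z hz => (ψ.left_inv hz.2).symm
  have himg : τ '' A = B := by
    ext w
    constructor
    · rintro ⟨z, hz, rfl⟩
      refine ⟨ψ.map_source hz.2, ?_⟩
      rw [mem_preimage, ← hinv z hz]
      exact φ.map_target hz.1
    · intro hw
      refine ⟨φ (ψ.symm w), ⟨φ.map_source hw.2, ?_⟩, ?_⟩
      · rw [mem_preimage, φ.left_inv hw.2]; exact ψ.map_target hw.1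
      · simp only [hτdef]
        rw [φ.left_inv hw.2, ψ.right_inv hw.1]
  have hinj : InjOn τ A := by
    intro z hz z' hz' h
    have : φ.symm z = φ.symm z' := by rw [hinv z hz, hinv z' hz', h]
    rw [← φ.right_inv hz.1, ← φ.right_inv hz'.1, this]
  have hτ : DifferentiableOn ℂ τ A := by
    intro z hz
    have h1 := contMDiffAt_of_mem_maximalAtlas (I := 𝓘(ℂ)) (n := ω)
      (IsManifold.chart_mem_maximalAtlas d) hz.2
    have h2 := h1.analyticAt_comp_chart_symm (c := c) (φ.map_target hz.1)
    rw [← hφ, φ.right_inv hz.1] at h2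
    exact h2.differentiableAt.differentiableWithinAt
  have hda : ∀ f : X → ℝ, ContMDiff 𝓘(ℝ, ℂ) 𝓘(ℝ, ℝ) ∞ f → ∀ z ∈ A,
      DifferentiableAt ℝ (fun w => f (ψ.symm w)) (τ z) := fun f hf z hz =>
    (contDiffAt_chart_of_contMDiff hf (ψ.map_source hz.2)).differentiableAt (by simp)
  rw [setIntegral_eq_of_subset_of_forall_sdiff_eq_zero φ.open_target.measurableSet
      (inter_subset_left : A ⊆ φ.target),
    setIntegral_eq_of_subset_of_forall_sdiff_eq_zero ψ.open_target.measurableSet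
      (inter_subset_left : B ⊆ ψ.target),
    show ψ.target ∩ ψ.symm ⁻¹' φ.source = τ '' A from himg.symm,
    integral_gradDot_image hA hτ hinj (hda g hg) (hda f hf)]
  · refine setIntegral_congr_fun hA.measurableSet fun z hz => gradDot_congr ?_ ?_
    all_goals
      filter_upwards [hA.mem_nhds hz] with w hw
      simp only [Function.comp]
      rw [hinv w hw]
  · rintro z ⟨hz, hzB⟩
    exact gradDot_eq_zero_of_eventuallyEq_zero (comp_chart_symm_eventuallyEq_zero hz
      fun h => hzB ⟨hz, hgs h⟩)
  · rintro z ⟨hz, hzA⟩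
    rw [gradDot_comm]
    exact gradDot_eq_zero_of_eventuallyEq_zero (comp_chart_symm_eventuallyEq_zero hz
      fun h => hzA ⟨hz, hfs h⟩)

variable (X) in
theorem finite_chartPartition_support :
    {c : X | (Function.support (chartPartition X c)).Nonempty}.Finite :=
  (chartPartition X).locallyFinite.finite_nonempty_of_compact

variable (X) in
/-- The indices of the functions of the chosen partition of unity which do not vanish. -/
def partitionIndex : Finset X := (finite_chartPartition_support X).toFinset

theorem chartPartition_eq_zero {c : X} (hc : c ∉ partitionIndex X) (x : X) :
    chartPartition X c x = 0 := by
  by_contra h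
  exact hc ((finite_chartPartition_support X).mem_toFinset.2 ⟨x, h⟩)

theorem sum_chartPartition (x : X) : ∑ c ∈ partitionIndex X, chartPartition X c x = 1 := by
  rw [← (chartPartition X).sum_eq_one (mem_univ x)]
  refine (finsum_eq_sum_of_support_subset _ fun c hc => ?_).symm
  by_contra h
  exact hc (chartPartition_eq_zero h x)

theorem integralTwoForm_eq_sum (η : X → ℂ → ℝ) :
    integralTwoForm η = ∑ c ∈ partitionIndex X, ∫ z in (chartAt ℂ c).target,
      chartPartition X c ((chartAt ℂ c).symm z) * η c z := by
  refine finsum_eq_sum_of_support_subset _ fun c hc => ?_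
  by_contra h
  exact hc (by simp [chartPartition_eq_zero h])

theorem contMDiff_chartPartition (c : X) :
    ContMDiff 𝓘(ℝ, ℂ) 𝓘(ℝ, ℝ) ∞ (chartPartition X c) :=
  (chartPartition X c).contMDiff

/-- Stokes' theorem: the integral of the Laplacian of a smooth function vanishes. -/
theorem integralTwoForm_laplacian {f : X → ℝ} (hf : ContMDiff 𝓘(ℝ, ℂ) 𝓘(ℝ, ℝ) ∞ f) :
    integralTwoForm (fun c : X =>
      Laplacian.laplacian (fun w => f ((chartAt ℂ c).symm w))) = 0 := by
  have hsub := chartPartition_isSubordinate X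
  set ρ := chartPartition X with hρ
  set D := partitionIndex X
  have hρs : ∀ c, ContMDiff 𝓘(ℝ, ℂ) 𝓘(ℝ, ℝ) ∞ (ρ c) := contMDiff_chartPartition
  have hρf : ∀ c, ContMDiff 𝓘(ℝ, ℂ) 𝓘(ℝ, ℝ) ∞ (fun x => ρ c x * f x) := fun c =>
    (hρs c).mul hf
  have hρft : ∀ c, tsupport (fun x => ρ c x * f x) ⊆ (chartAt ℂ c).source := fun c =>
    tsupport_mul_subset_left.trans (hsub c)
  have hfsum : ∀ x, f x = ∑ d ∈ D, ρ d x * f x := fun x => by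
    rw [← Finset.sum_mul, sum_chartPartition, one_mul]
  have hd : ∀ (g : X → ℝ), ContMDiff 𝓘(ℝ, ℂ) 𝓘(ℝ, ℝ) ∞ g → ∀ (c : X), ∀ z ∈ (chartAt ℂ c).target,
      DifferentiableAt ℝ (fun w => g ((chartAt ℂ c).symm w)) z := fun g hg c z hz =>
    (contDiffAt_chart_of_contMDiff hg hz).differentiableAt (by simp)
  -- Splitting f as the sum of the ρ_d f lets each term be moved from the chart at c to the chart at
  -- d.
  have h1 : ∀ c, ∫ z in (chartAt ℂ c).target, gradDot (fun w => ρ c ((chartAt ℂ c).symm w))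
        (fun w => f ((chartAt ℂ c).symm w)) z = ∑ d ∈ D, ∫ z in (chartAt ℂ d).target,
        gradDot (fun w => ρ c ((chartAt ℂ d).symm w))
        (fun w => ρ d ((chartAt ℂ d).symm w) * f ((chartAt ℂ d).symm w)) z := by
    intro c
    rw [← Finset.sum_congr rfl (fun d _ =>
      integral_chart_gradDot_eq (hρs c) (hρf d) (hsub c) (hρft d)),
      ← integral_finsetSum _ (fun d _ => integrableOn_chart_gradDot (hρs c) (hρf d) (hsub c))]
    refine setIntegral_congr_fun (chartAt ℂ c).open_target.measurableSet fun z hz => ?_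
    rw [← gradDot_sum_right D (fun d _ => hd _ (hρf d) c z hz)]
    exact gradDot_congr EventuallyEq.rfl (Eventually.of_forall fun w => hfsum _)
  -- In the fixed chart at d the sum over c can be taken under the integral, and the functions ρ_c
  -- add up to 1, whose gradient is zero.
  have h2 : ∀ d, ∑ c ∈ D, ∫ z in (chartAt ℂ d).target,
        gradDot (fun w => ρ c ((chartAt ℂ d).symm w))
        (fun w => ρ d ((chartAt ℂ d).symm w) * f ((chartAt ℂ d).symm w)) z = 0 := by
    intro d
    simp only [gradDot_comm (fun w => ρ _ ((chartAt ℂ d).symm w))]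
    rw [← integral_finsetSum _ (fun c _ => integrableOn_chart_gradDot (hρf d) (hρs c) (hρft d))]
    rw [setIntegral_congr_fun (g := fun _ => (0 : ℝ)) (chartAt ℂ d).open_target.measurableSet]
    · simp
    intro z hz
    simp only
    rw [← gradDot_sum_right D (fun c _ => hd _ (hρs c) d z hz), gradDot_comm]
    have : (fun w => ∑ c ∈ D, ρ c ((chartAt ℂ d).symm w)) = fun _ => (1 : ℝ) :=
      funext fun w => sum_chartPartition _
    rw [this]
    simp [gradDot]
  rw [integralTwoForm_eq_sum]
  rw [Finset.sum_congr rfl fun c _ => integral_chart_mul_laplacian (hρs c) hf (hsub c),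
    Finset.sum_neg_distrib, Finset.sum_congr rfl fun c _ => h1 c, Finset.sum_comm,
    Finset.sum_congr rfl fun d _ => h2 d]
  simp

end

end

/-! ### Germs of holomorphic functions and Smith normal form. -/

noncomputable section

open Filter Topology Complex

/-- The ring of germs at `z₀` of holomorphic functions. -/
def analyticGerm (z₀ : ℂ) : Subring (Germ (𝓝 z₀) ℂ) where
  carrier := {g | ∃ f : ℂ → ℂ, AnalyticAt ℂ f z₀ ∧ (f : Germ (𝓝 z₀) ℂ) = g}
  mul_mem' := by
    rintro _ _ ⟨f, hf, rfl⟩ ⟨g, hg, rfl⟩; exact ⟨f * g, hf.mul hg, rfl⟩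
  add_mem' := by
    rintro _ _ ⟨f, hf, rfl⟩ ⟨g, hg, rfl⟩; exact ⟨f + g, hf.add hg, rfl⟩
  one_mem' := ⟨1, analyticAt_const, rfl⟩
  zero_mem' := ⟨0, analyticAt_const, rfl⟩
  neg_mem' := by
    rintro _ ⟨f, hf, rfl⟩; exact ⟨-f, hf.neg, rfl⟩

namespace analyticGerm

variable {z₀ : ℂ}

/-- The germ of a holomorphic function. -/
def of (f : ℂ → ℂ) (hf : AnalyticAt ℂ f z₀) : analyticGerm z₀ := ⟨f, f, hf, rfl⟩

/-- A representative of a germ. -/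
def rep (g : analyticGerm z₀) : ℂ → ℂ := g.2.choose

theorem analyticAt_rep (g : analyticGerm z₀) : AnalyticAt ℂ (rep g) z₀ := g.2.choose_spec.1

theorem coe_rep (g : analyticGerm z₀) : ((rep g : ℂ → ℂ) : Germ (𝓝 z₀) ℂ) = g :=
  g.2.choose_spec.2

theorem of_rep (g : analyticGerm z₀) : of (rep g) (analyticAt_rep g) = g := Subtype.ext (coe_rep g)

theorem of_eq_iff {f g : ℂ → ℂ} (hf : AnalyticAt ℂ f z₀) (hg : AnalyticAt ℂ g z₀) :
    of f hf = of g hg ↔ f =ᶠ[𝓝 z₀] g := by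
  rw [Subtype.ext_iff]; exact Germ.coe_eq

theorem rep_of {f : ℂ → ℂ} (hf : AnalyticAt ℂ f z₀) : rep (of f hf) =ᶠ[𝓝 z₀] f :=
  (of_eq_iff (analyticAt_rep _) hf).1 (of_rep _)

/-- The value of a germ at the base point. -/
def eval (z₀ : ℂ) : analyticGerm z₀ →+* ℂ :=
  (Germ.valueRingHom (X := ℂ) (E := ℂ) (x := z₀)).comp (analyticGerm z₀).subtype

theorem eval_of {f : ℂ → ℂ} (hf : AnalyticAt ℂ f z₀) : eval z₀ (of f hf) = f z₀ := rfl

theorem eval_eq_rep (g : analyticGerm z₀) : eval z₀ g = rep g z₀ := by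
  conv_lhs => rw [← of_rep g, eval_of]

theorem isUnit_iff (g : analyticGerm z₀) : IsUnit g ↔ eval z₀ g ≠ 0 := by
  refine ⟨fun h => (h.map (eval z₀)).ne_zero, fun h => ?_⟩
  rw [eval_eq_rep] at h
  have ha := analyticAt_rep g
  refine IsUnit.of_mul_eq_one (of _ (ha.inv h)) ?_
  have : g * of _ (ha.inv h) = of _ (ha.mul (ha.inv h)) := by
    exact congrArg (· * of _ (ha.inv h)) (of_rep g).symm
  rw [this]
  refine (of_eq_iff (g := fun _ => 1) _ analyticAt_const).2 ?_
  filter_upwards [ha.continuousAt.eventually_ne h] with z hz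
  simp [mul_inv_cancel₀ hz]

instance : Nontrivial (analyticGerm z₀) :=
  ⟨⟨0, 1, fun h => zero_ne_one (α := ℂ) (by simpa using congrArg (eval z₀) h)⟩⟩

/-- Isolated zeros: a germ that is not zero has no zeros in a punctured neighbourhood, and two such
neighbourhoods meet. -/
instance : NoZeroDivisors (analyticGerm z₀) where
  eq_zero_or_eq_zero_of_mul_eq_zero {a b} h := by
    rw [← of_rep a, ← of_rep b] at h ⊢
    have h' : (fun z => rep a z * rep b z) =ᶠ[𝓝 z₀] fun _ => 0 :=
      (of_eq_iff ((analyticAt_rep a).mul (analyticAt_rep b)) analyticAt_const).1 h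
    rcases (analyticAt_rep a).eventually_eq_zero_or_eventually_ne_zero with h0 | h0
    · exact Or.inl ((of_eq_iff (g := fun _ => 0) _ analyticAt_const).2 h0)
    · right
      rcases (analyticAt_rep b).eventually_eq_zero_or_eventually_ne_zero with h1 | h1
      · exact (of_eq_iff (g := fun _ => 0) _ analyticAt_const).2 h1
      · obtain ⟨z, hz⟩ := ((h'.filter_mono nhdsWithin_le_nhds).and (h0.and h1)).exists
        exact absurd hz.1 (mul_ne_zero hz.2.1 hz.2.2)

instance : IsDomain (analyticGerm z₀) := NoZeroDivisors.to_isDomain _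

theorem analyticAt_sub_const (z₀ : ℂ) : AnalyticAt ℂ (fun z => z - z₀) z₀ :=
  analyticAt_id.sub analyticAt_const

/-- The germ of `z - z₀`. -/
def uniformizer (z₀ : ℂ) : analyticGerm z₀ := of _ (analyticAt_sub_const z₀)

/-- Two non-units vanish at z₀, so by the product rule their product has derivative 0 there, while z
- z₀ has derivative 1. -/
theorem irreducible_uniformizer : Irreducible (uniformizer z₀) := by
  refine ⟨fun h => ?_, fun a b h => ?_⟩
  · exact (isUnit_iff _).1 h (by simp [uniformizer, eval_of])
  · by_contra! hab
    rw [isUnit_iff, isUnit_iff, not_not, not_not, eval_eq_rep, eval_eq_rep] at hab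
    rw [← of_rep a, ← of_rep b] at h
    have h' : (fun z => z - z₀) =ᶠ[𝓝 z₀] fun z => rep a z * rep b z :=
      (of_eq_iff (analyticAt_sub_const z₀) ((analyticAt_rep a).mul (analyticAt_rep b))).1 h
    have h1 : HasDerivAt (fun z => rep a z * rep b z) 1 z₀ :=
      ((hasDerivAt_id z₀).sub_const z₀).congr_of_eventuallyEq h'.symm
    have h2 := (analyticAt_rep a).differentiableAt.hasDerivAt.mul
      (analyticAt_rep b).differentiableAt.hasDerivAt
    have := h1.unique h2
    simp [hab.1, hab.2] at this

theorem exists_associated_pow {g : analyticGerm z₀} (hg : g ≠ 0) :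
    ∃ n : ℕ, Associated (uniformizer z₀ ^ n) g := by
  have h0 : ¬ ∀ᶠ z in 𝓝 z₀, rep g z = 0 := fun h => hg (by
    rw [← of_rep g]; exact (of_eq_iff (g := fun _ => 0) _ analyticAt_const).2 h)
  obtain ⟨n, f, hf, hf0, h⟩ :=
    (analyticAt_rep g).exists_eventuallyEq_pow_smul_nonzero_iff.2 h0
  refine ⟨n, ((isUnit_iff (of f hf)).2 hf0).unit, ?_⟩
  rw [IsUnit.unit_spec, ← of_rep g]
  exact (of_eq_iff (((analyticAt_sub_const z₀).pow n).mul hf) _).2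
    (by filter_upwards [h] with z hz; rw [hz]; rfl)

instance : IsDiscreteValuationRing (analyticGerm z₀) :=
  IsDiscreteValuationRing.ofHasUnitMulPowIrreducibleFactorization
    ⟨uniformizer z₀, irreducible_uniformizer, fun h => exists_associated_pow h⟩

/-- Evaluation at z₀ is a ring homomorphism, so it carries the one-sided inverse of the matrix of b
to a left inverse over ℂ. This turns bases of germs into families independent at the base point. -/
theorem linearIndependent_eval {ι κ : Type*} [Fintype ι] [Fintype κ]
    (b : Module.Basis ι (analyticGerm z₀) (κ → analyticGerm z₀)) :
    LinearIndependent ℂ (fun i j => rep (b i j) z₀) := by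
  classical
  have h : b.toMatrix (Pi.basisFun _ κ) * (Pi.basisFun (analyticGerm z₀) κ).toMatrix b = 1 :=
    b.toMatrix_mul_toMatrix_flip _
  have h2 := congrArg (fun M => M.map (eval z₀)) h
  simp only [Matrix.map_mul, Matrix.map_one _ (map_zero (eval z₀)) (map_one (eval z₀))] at h2
  set E := ((Pi.basisFun (analyticGerm z₀) κ).toMatrix b).map (eval z₀) with hE
  have hcol : (fun i j => rep (b i j) z₀) = E.col := by
    funext i j
    simp [hE, Matrix.col, Module.Basis.toMatrix_apply, eval_eq_rep]
  rw [hcol, ← Matrix.mulVec_injective_iff]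
  exact Function.LeftInverse.injective (g := Matrix.mulVec
    ((b.toMatrix (Pi.basisFun _ κ)).map (eval z₀))) fun c => by
      rw [Matrix.mulVec_mulVec, h2, Matrix.one_mulVec]

end analyticGerm

open analyticGerm in
/-- Smith normal form of a matrix of holomorphic functions near a point. -/
theorem exists_analytic_smith {r r' : ℕ} {z₀ : ℂ} (B : ℂ → Matrix (Fin r') (Fin r) ℂ)
    (hB : ∀ i j, AnalyticAt ℂ (fun z => B z i j) z₀) :
    ∃ (n m k : ℕ) (_ : n + m = r) (_ : m + k = r') (P : Fin n ⊕ Fin m → Fin r → ℂ → ℂ)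
      (Q : Fin m ⊕ Fin k → Fin r' → ℂ → ℂ) (d : Fin m → ℕ),
      (∀ i j, AnalyticAt ℂ (P i j) z₀) ∧ (∀ i j, AnalyticAt ℂ (Q i j) z₀) ∧
      LinearIndependent ℂ (fun i j => P i j z₀) ∧ LinearIndependent ℂ (fun i j => Q i j z₀) ∧
      (∀ᶠ z in 𝓝 z₀, ∀ i, (B z).mulVec (fun j => P (Sum.inl i) j z) = 0) ∧
      (∀ᶠ z in 𝓝 z₀, ∀ i, (B z).mulVec (fun j => P (Sum.inr i) j z) =
        (z - z₀) ^ d i • fun j => Q (Sum.inl i) j z) := by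
  classical
  let R := analyticGerm z₀
  let M : Matrix (Fin r') (Fin r) R := fun i j => of _ (hB i j)
  let T : (Fin r → R) →ₗ[R] (Fin r' → R) := M.mulVecLin
  obtain ⟨m, bM, bN₀, f, a, snf⟩ :=
    Submodule.smithNormalForm (Pi.basisFun R (Fin r')) (LinearMap.range T)
  obtain ⟨n, bK⟩ := Submodule.basisOfPid (Pi.basisFun R (Fin r)) (LinearMap.ker T)
  have ha : ∀ i, a i ≠ 0 := fun i h => bN₀.ne_zero i (Subtype.ext (by rw [snf, h]; simp))
  choose d hd using fun i => exists_associated_pow (ha i)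
  choose w hw using hd
  -- Each diagonal entry is a unit times a power of the uniformizer; rescaling the basis of the
  -- range by the inverse units leaves exact powers.
  let bN := bN₀.unitsSMul fun i => (w i)⁻¹
  have hbN : ∀ i, (bN i : Fin r' → R) = uniformizer z₀ ^ d i • bM (f i) := by
    intro i
    have : bN i = (↑(w i)⁻¹ : R) • bN₀ i := by
      rw [Module.Basis.unitsSMul_apply]; rfl
    rw [this, Submodule.coe_smul, snf, ← hw, smul_smul]
    congr 1
    rw [mul_comm (uniformizer z₀ ^ d i), ← mul_assoc, Units.inv_mul, one_mul]
  choose e he using fun i => (bN i).2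
  -- The range is free, so the surjection onto it splits: a basis of the kernel together with lifts
  -- of a basis of the range is a basis of the source.
  let p : Fin n ⊕ Fin m → (Fin r → R) := Sum.elim (fun i => (bK i : Fin r → R)) e
  have hli : LinearIndependent R p := by
    refine LinearIndependent.sum_type
      (bK.linearIndependent.map' (LinearMap.ker T).subtype (Submodule.ker_subtype _)) ?_ ?_
    · refine LinearIndependent.of_comp T ?_
      have : T ∘ e = fun i => (LinearMap.range T).subtype (bN i) := funext he
      rw [this]
      exact bN.linearIndependent.map' _ (Submodule.ker_subtype _)
    · rw [Submodule.disjoint_def]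
      intro x hx hx'
      have hxk : T x = 0 := by
        have : Submodule.span R (range fun i => (bK i : Fin r → R)) ≤ LinearMap.ker T := by
          rw [Submodule.span_le]; rintro _ ⟨i, rfl⟩; exact (bK i).2
        exact this hx
      obtain ⟨c, rfl⟩ := (Submodule.mem_span_range_iff_exists_fun R).1 hx'
      have h0 : ∑ i, c i • bN i = 0 := Subtype.ext (by
        simpa [he] using hxk)
      have := Fintype.linearIndependent_iff.1 bN.linearIndependent c h0
      simp [this]
  have hsp : ⊤ ≤ Submodule.span R (range p) := by
    intro x _
    have hx : T x ∈ LinearMap.range T := ⟨x, rfl⟩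
    set c := bN.repr ⟨T x, hx⟩ with hc
    have h1 : T x = ∑ i, c i • T (e i) := by
      have := congrArg Subtype.val (bN.sum_repr ⟨T x, hx⟩)
      simp only [AddSubmonoidClass.coe_finsetSum, Submodule.coe_smul] at this
      rw [← this]
      exact Finset.sum_congr rfl fun i _ => by rw [he]
    have h2 : x - ∑ i, c i • e i ∈ LinearMap.ker T := by
      rw [LinearMap.mem_ker, map_sub, map_sum, h1]; simp
    have h3 : x - ∑ i, c i • e i ∈ Submodule.span R (range p) := by
      have h4 := congrArg Subtype.val (bK.sum_repr ⟨_, h2⟩)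
      simp only [AddSubmonoidClass.coe_finsetSum, Submodule.coe_smul] at h4
      rw [← h4]
      exact Submodule.sum_mem _ fun i _ => Submodule.smul_mem _ _
        (Submodule.subset_span ⟨Sum.inl i, rfl⟩)
    rw [← sub_add_cancel x (∑ i, c i • e i)]
    exact Submodule.add_mem _ h3 (Submodule.sum_mem _ fun i _ => Submodule.smul_mem _ _
        (Submodule.subset_span ⟨Sum.inr i, rfl⟩))
  let bP := Module.Basis.mk hli hsp
  have hr : n + m = r := by
    have := Module.finrank_eq_card_basis bP
    simpa using this.symm
  let C := {x // x ∉ range f}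
  let k := Fintype.card C
  -- The basis of the target is reordered so that the vectors supporting the range come first.
  let σ : Fin m ⊕ Fin k ≃ Fin r' :=
    (Equiv.sumCongr (Equiv.ofInjective f f.injective) (Fintype.equivFin C).symm).trans
      (Equiv.Set.sumCompl (range f))
  have hσ : ∀ i, σ (Sum.inl i) = f i := fun i => rfl
  have hr' : m + k = r' := by simpa using Fintype.card_congr σ
  let bQ := bM.reindex σ.symm
  have hev : ∀ (x : Fin r → R) (y : Fin r' → R), T x = y →
      ∀ᶠ z in 𝓝 z₀, (B z).mulVec (fun j => rep (x j) z) = fun j => rep (y j) z := by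
    intro x y hxy
    have h1 : ∀ i, ∀ᶠ z in 𝓝 z₀, ∑ j, B z i j * rep (x j) z = rep (y i) z := by
      intro i
      have hs : AnalyticAt ℂ (fun z => ∑ j, B z i j * rep (x j) z) z₀ :=
        Finset.analyticAt_fun_sum _ fun j _ => (hB i j).mul (analyticAt_rep _)
      refine (of_eq_iff hs (analyticAt_rep _)).1 ?_
      rw [of_rep, ← hxy]
      apply Subtype.ext
      have h2 : (∑ j, M i j * x j : R) = T x i := rfl
      rw [← h2, AddSubmonoidClass.coe_finsetSum]
      have h3 : ∀ j, ((M i j * x j : R) : Germ (𝓝 z₀) ℂ) =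
          Germ.coeRingHom (𝓝 z₀) (fun z => B z i j * rep (x j) z) := by
        intro j
        conv_lhs => rw [← of_rep (x j)]
        rfl
      rw [Finset.sum_congr rfl fun j _ => h3 j, ← map_sum]
      change ((_ : ℂ → ℂ) : Germ (𝓝 z₀) ℂ) = ((_ : ℂ → ℂ) : Germ (𝓝 z₀) ℂ)
      congr 1
      funext z
      simp
    filter_upwards [eventually_all.2 h1] with z hz
    funext i
    exact hz i
  refine ⟨n, m, k, hr, hr', fun i j => rep (bP i j), fun i j => rep (bQ i j), d,
    fun i j => analyticAt_rep _, fun i j => analyticAt_rep _, linearIndependent_eval bP,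
    linearIndependent_eval bQ, eventually_all.2 fun i => ?_, eventually_all.2 fun i => ?_⟩
  · have h1 : T (bP (Sum.inl i)) = 0 := by
      rw [Module.Basis.mk_apply]; exact (bK i).2
    have h2 : ∀ᶠ z in 𝓝 z₀, rep (0 : R) z = 0 := rep_of (f := fun _ => 0) analyticAt_const
    filter_upwards [hev _ _ h1, h2] with z hz hz2
    rw [hz]
    funext j
    exact hz2
  · have h1 : T (bP (Sum.inr i)) = uniformizer z₀ ^ d i • bQ (Sum.inl i) := by
      rw [Module.Basis.mk_apply, Module.Basis.reindex_apply]
      change T (e i) = uniformizer z₀ ^ d i • bM (f i)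
      rw [he, hbN]
    have h2 : ∀ j, ∀ᶠ z in 𝓝 z₀, rep ((uniformizer z₀ ^ d i • bQ (Sum.inl i)) j) z =
        (z - z₀) ^ d i * rep (bQ (Sum.inl i) j) z := by
      intro j
      refine (of_eq_iff (analyticAt_rep _)
        (((analyticAt_sub_const z₀).pow (d i)).mul (analyticAt_rep _))).1 ?_
      rw [of_rep, Pi.smul_apply, smul_eq_mul]
      conv_lhs => rw [← of_rep (bQ (Sum.inl i) j)]
      rfl
    filter_upwards [hev _ _ h1, eventually_all.2 h2] with z hz hz2
    rw [hz]
    funext j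
    exact hz2 j

end

/-! ### Holomorphic sections in local coordinates. -/

noncomputable section

variable {X : Type u} [TopologicalSpace X] [ChartedSpace ℂ X] [IsManifold 𝓘(ℂ) ω X]
open Filter Topology Complex

section Det

variable {𝕜 A : Type*} [NontriviallyNormedField 𝕜] [NormedCommRing A] [NormedAlgebra 𝕜 A]
  {ι : Type*} [Fintype ι] [DecidableEq ι] {n : ℕ∞ω}

theorem contDiff_matrix_det : ContDiff 𝕜 n (fun M : ι → ι → A => (Matrix.of M).det) := by
  simp only [Matrix.det_apply, Matrix.of_apply]
  refine ContDiff.sum fun σ _ => ContDiff.const_smul _ (contDiff_prod fun i _ => ?_)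
  exact contDiff_apply_apply 𝕜 A (σ i) i

theorem contDiff_matrix_adjugate (i j : ι) :
    ContDiff 𝕜 n (fun M : ι → ι → A => (Matrix.of M).adjugate i j) := by
  simp only [Matrix.adjugate_apply]
  have h : ContDiff 𝕜 n (fun (M : ι → ι → A) a b =>
      (Matrix.of M).updateRow j (Pi.single i 1) a b) := by
    refine contDiff_pi.2 fun a => contDiff_pi.2 fun b => ?_
    simp only [Matrix.updateRow_apply, Matrix.of_apply]
    split_ifs
    · exact contDiff_const
    · exact contDiff_apply_apply 𝕜 A a b
  exact contDiff_matrix_det.comp h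

end Det

namespace HolVB

variable {r : ℕ} (V : HolVB.{u, v} X r)

/-- `s` is holomorphic near `x`. -/
def HolAt (x : X) (s : ∀ x, V.Fiber x) : Prop :=
  ContMDiffAt 𝓘(ℂ) (𝓘(ℂ).prod 𝓘(ℂ, EuclideanSpace ℂ (Fin r))) ω
    (fun x => TotalSpace.mk' (EuclideanSpace ℂ (Fin r)) x (s x)) x

/-- The domain of the preferred trivialization at `x`. -/
def base (x : X) : Set X := (trivializationAt (EuclideanSpace ℂ (Fin r)) V.Fiber x).baseSet

theorem isOpen_base (x : X) : IsOpen (V.base x) := Trivialization.open_baseSet _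

theorem mem_base (x : X) : x ∈ V.base x := mem_baseSet_trivializationAt _ _ x

/-- The coordinates in the fibre at `y` given by the preferred trivialization at `x`. -/
def coord (x y : X) : V.Fiber y →ₗ[ℂ] (Fin r → ℂ) :=
  (WithLp.linearEquiv 2 ℂ (Fin r → ℂ)).toLinearMap ∘ₗ
    (trivializationAt (EuclideanSpace ℂ (Fin r)) V.Fiber x).linearMapAt ℂ y

/-- The vector in the fibre at `y` with given coordinates. -/
def uncoord (x y : X) : (Fin r → ℂ) →ₗ[ℂ] V.Fiber y :=
  (trivializationAt (EuclideanSpace ℂ (Fin r)) V.Fiber x).symmₗ ℂ y ∘ₗ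
    (WithLp.linearEquiv 2 ℂ (Fin r → ℂ)).symm.toLinearMap

variable {V} {x y : X}

theorem coord_uncoord (hy : y ∈ V.base x) (c : Fin r → ℂ) :
    V.coord x y (V.uncoord x y c) = c := by
  simp only [coord, uncoord, LinearMap.comp_apply]
  rw [Trivialization.linearMapAt_symmₗ _ hy]
  simp

theorem uncoord_coord (hy : y ∈ V.base x) (w : V.Fiber y) :
    V.uncoord x y (V.coord x y w) = w := by
  simp only [coord, uncoord, LinearMap.comp_apply, LinearEquiv.coe_coe,
    LinearEquiv.symm_apply_apply]
  exact Trivialization.symmₗ_linearMapAt _ hy w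

variable (V) in
/-- The preferred trivialization at `x`, in the fibre at `y`. -/
def coordEquiv (hy : y ∈ V.base x) : V.Fiber y ≃ₗ[ℂ] (Fin r → ℂ) :=
  LinearEquiv.ofLinearMap (V.coord x y) (V.uncoord x y)
    (LinearMap.ext (coord_uncoord hy)) (LinearMap.ext (uncoord_coord hy))

variable (V) in
theorem finrank_fiber (x : X) : Module.finrank ℂ (V.Fiber x) = r := by
  rw [(V.coordEquiv (V.mem_base x)).finrank_eq]; simp

instance finite_fiber (x : X) : Module.Finite ℂ (V.Fiber x) :=
  Module.Finite.equiv (V.coordEquiv (V.mem_base x)).symm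

theorem holAt_iff {s : ∀ x, V.Fiber x} (hy : y ∈ V.base x) :
    V.HolAt y s ↔ ContMDiffAt 𝓘(ℂ) 𝓘(ℂ, Fin r → ℂ) ω (fun z => V.coord x z (s z)) y := by
  have h1 := (trivializationAt (EuclideanSpace ℂ (Fin r)) V.Fiber x).contMDiffAt_section_iff
    (IB := 𝓘(ℂ)) (n := ω) (s := s) hy
  refine h1.trans ?_
  let E := EuclideanSpace.equiv (Fin r) ℂ
  have hcoord : (fun z => V.coord x z (s z)) =ᶠ[𝓝 y] fun z =>
      E ((trivializationAt (EuclideanSpace ℂ (Fin r)) V.Fiber x) ⟨z, s z⟩).2 := by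
    filter_upwards [(V.isOpen_base x).mem_nhds hy] with z hz
    simp only [coord, LinearMap.comp_apply, Trivialization.linearMapAt_apply]
    rw [if_pos (show z ∈ (trivializationAt _ V.Fiber x).baseSet from hz)]
    rfl
  rw [hcoord.contMDiffAt_iff]
  constructor
  · intro h
    exact (E.contDiff.contMDiff.contMDiffAt).comp y h
  · intro h
    have := (E.symm.contDiff (n := ω)).contMDiff.contMDiffAt.comp y h
    simpa [Function.comp_def] using this

theorem IsHolOn.holAt {s : ∀ x, V.Fiber x} {U : Set X} (h : V.IsHolOn U s) (hU : IsOpen U)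
    (hx : x ∈ U) : V.HolAt x s := h.contMDiffAt (hU.mem_nhds hx)

theorem HolAt.eventually {s : ∀ x, V.Fiber x} (h : V.HolAt x s) : ∀ᶠ y in 𝓝 x, V.HolAt y s :=
  (contMDiffAt_iff_contMDiffAt_nhds (by simp)).1 h

theorem isHolOn_of_holAt {s : ∀ x, V.Fiber x} {U : Set X} (h : ∀ y ∈ U, V.HolAt y s) :
    V.IsHolOn U s := fun y hy => (h y hy).contMDiffWithinAt

theorem HolAt.exists_isHolOn {s : ∀ x, V.Fiber x} (h : V.HolAt x s) :
    ∃ U, IsOpen U ∧ x ∈ U ∧ V.IsHolOn U s := by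
  obtain ⟨U, hU, hUo, hx⟩ := eventually_nhds_iff.1 h.eventually
  exact ⟨U, hUo, hx, isHolOn_of_holAt hU⟩

theorem HolAt.add {s t : ∀ x, V.Fiber x} (hs : V.HolAt x s) (ht : V.HolAt x t) :
    V.HolAt x (fun y => s y + t y) := by
  rw [holAt_iff (V.mem_base x)] at hs ht ⊢
  simp only [map_add]
  exact hs.add ht

theorem HolAt.smul {s : ∀ x, V.Fiber x} {c : X → ℂ} (hc : ContMDiffAt 𝓘(ℂ) 𝓘(ℂ) ω c x)
    (hs : V.HolAt x s) : V.HolAt x (fun y => c y • s y) := by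
  rw [holAt_iff (V.mem_base x)] at hs ⊢
  simp only [map_smul]
  exact hc.smul hs

theorem holAt_uncoord {c : X → Fin r → ℂ} (hy : y ∈ V.base x)
    (hc : ContMDiffAt 𝓘(ℂ) 𝓘(ℂ, Fin r → ℂ) ω c y) :
    V.HolAt y (fun z => V.uncoord x z (c z)) := by
  rw [holAt_iff hy]
  refine hc.congr_of_eventuallyEq ?_
  filter_upwards [(V.isOpen_base x).mem_nhds hy] with z hz
  exact coord_uncoord hz _

theorem holAt_zero : V.HolAt x (fun _ => 0) := by
  simpa using holAt_uncoord (V.mem_base x) (contMDiffAt_const (c := 0))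

theorem linearIndependent_coord_iff {ι : Type*} {e : ι → ∀ y, V.Fiber y} (hy : y ∈ V.base x) :
    LinearIndependent ℂ (fun i => V.coord x y (e i y)) ↔ LinearIndependent ℂ fun i => e i y :=
  LinearMap.linearIndependent_iff (V.coordEquiv hy).toLinearMap
    (V.coordEquiv hy).ker

theorem eventually_linearIndependent {ι : Type*} [Finite ι] {e : ι → ∀ y, V.Fiber y}
    (he : ∀ i, V.HolAt x (e i)) (hli : LinearIndependent ℂ fun i => e i x) :
    ∀ᶠ y in 𝓝 x, LinearIndependent ℂ fun i => e i y := by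
  cases nonempty_fintype ι
  have hc : ContinuousAt (fun y i => V.coord x y (e i y)) x :=
    continuousAt_pi.2 fun i => ((holAt_iff (V.mem_base x)).1 (he i)).continuousAt
  have h := hc.eventually ((linearIndependent_coord_iff (V.mem_base x)).2 hli).eventually
  filter_upwards [h, (V.isOpen_base x).mem_nhds (V.mem_base x)] with y hy hb
  exact (linearIndependent_coord_iff hb).1 hy

/-- A holomorphic section lying in the span of pointwise linearly independent holomorphic sections
has holomorphic coefficients. -/
theorem exists_holomorphic_coeff {ι : Type*} [Fintype ι] {e : ι → ∀ y, V.Fiber y}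
    (he : ∀ i, V.HolAt x (e i)) (hli : LinearIndependent ℂ fun i => e i x)
    {s : ∀ y, V.Fiber y} (hs : V.HolAt x s)
    (hmem : ∀ᶠ y in 𝓝 x, s y ∈ Submodule.span ℂ (range fun i => e i y)) :
    ∃ c : ι → X → ℂ, (∀ i, ContMDiffAt 𝓘(ℂ) 𝓘(ℂ) ω (c i) x) ∧
      ∀ᶠ y in 𝓝 x, s y = ∑ i, c i y • e i y := by
  classical
  have hx := V.mem_base x
  have hli' := (linearIndependent_coord_iff hx).2 hli
  -- T is a left inverse of the frame at x only. The matrix N(y) of T on the frame at y is the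
  -- identity at y = x, hence invertible nearby, and Cramer's rule expresses the coefficients
  -- holomorphically.
  obtain ⟨T, hT⟩ := (Fintype.linearCombination ℂ
    fun i => V.coord x x (e i x)).exists_leftInverse_of_injective
      (LinearMap.ker_eq_bot.2 (linearIndependent_iff_injective_fintypeLinearCombination.1 hli'))
  let T' : (Fin r → ℂ) →L[ℂ] (ι → ℂ) := LinearMap.toContinuousLinearMap T
  let N : X → Matrix ι ι ℂ := fun y => Matrix.of fun i j => T (V.coord x y (e j y)) i
  have hN : ContMDiffAt 𝓘(ℂ) 𝓘(ℂ, ι → ι → ℂ) ω (fun y i j => T (V.coord x y (e j y)) i) x := by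
    refine contMDiffAt_pi_space.2 fun i => contMDiffAt_pi_space.2 fun j => ?_
    have := (T'.contDiff (n := ω)).contMDiff.contMDiffAt.comp x ((holAt_iff hx).1 (he j))
    exact contMDiffAt_pi_space.1 this i
  have hTs : ∀ i, ContMDiffAt 𝓘(ℂ) 𝓘(ℂ) ω (fun y => T (V.coord x y (s y)) i) x := by
    intro i
    have := (T'.contDiff (n := ω)).contMDiff.contMDiffAt.comp x ((holAt_iff hx).1 hs)
    exact contMDiffAt_pi_space.1 this i
  have hdet : ContMDiffAt 𝓘(ℂ) 𝓘(ℂ) ω (fun y => (N y).det) x :=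
    (contDiff_matrix_det (𝕜 := ℂ) (A := ℂ)).contMDiff.contMDiffAt.comp x hN
  have hadj : ∀ i j, ContMDiffAt 𝓘(ℂ) 𝓘(ℂ) ω (fun y => (N y).adjugate i j) x := fun i j =>
    (contDiff_matrix_adjugate (𝕜 := ℂ) (A := ℂ) i j).contMDiff.contMDiffAt.comp x hN
  have hN1 : N x = 1 := by
    ext i j
    have := congrFun (LinearMap.congr_fun hT (Pi.single j 1)) i
    simp only [LinearMap.comp_apply, Fintype.linearCombination_apply_single, one_smul,
      LinearMap.id_apply] at this
    simp only [N, Matrix.of_apply, this, Matrix.one_apply, Pi.single_apply]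
  have hdet0 : (N x).det ≠ 0 := by rw [hN1]; simp
  refine ⟨fun i y => (N y).det⁻¹ * ∑ j, (N y).adjugate i j * T (V.coord x y (s y)) j,
    fun i => ?_, ?_⟩
  · have hinv : ContMDiffAt 𝓘(ℂ) 𝓘(ℂ) ω (fun y => ((N y).det)⁻¹) x :=
      ((contDiffAt_inv ℂ hdet0).contMDiffAt (n := ω)).comp x hdet
    refine hinv.mul ?_
    exact contMDiffAt_finsetSum fun j _ => (hadj i j).mul (hTs j)
  · filter_upwards [hmem, hdet.continuousAt.eventually_ne hdet0] with y hy hd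
    obtain ⟨a, ha⟩ := (Submodule.mem_span_range_iff_exists_fun ℂ).1 hy
    rw [← ha]
    refine Finset.sum_congr rfl fun i _ => ?_
    congr 1
    have h1 : (fun j => T (V.coord x y (∑ i, a i • e i y)) j) = (N y).mulVec a := by
      funext j
      simp [N, Matrix.mulVec, dotProduct, mul_comm]
    have h2 : ∑ j, (N y).adjugate i j * T (V.coord x y (∑ i, a i • e i y)) j =
        ((N y).adjugate.mulVec ((N y).mulVec a)) i := by
      rw [← h1]; rfl
    rw [h2, Matrix.mulVec_mulVec, Matrix.adjugate_mul, Matrix.smul_mulVec, Matrix.one_mulVec,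
      Pi.smul_apply, smul_eq_mul, ← mul_assoc, inv_mul_cancel₀ hd, one_mul]

theorem span_eq_top_of_linearIndependent {ι : Type*} [Fintype ι] {e : ι → V.Fiber y}
    (hli : LinearIndependent ℂ e) (hc : Fintype.card ι = r) :
    Submodule.span ℂ (range e) = ⊤ :=
  hli.span_eq_top_of_card_eq_finrank' (by rw [hc, V.finrank_fiber])

end HolVB

end

/-! ### Local normal forms of twisted maps. -/

noncomputable section

variable {X : Type u} [TopologicalSpace X] [ChartedSpace ℂ X] [IsManifold 𝓘(ℂ) ω X]
open Filter Topology Complex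

theorem exists_smul_of_rank_one {F : Type*} [AddCommGroup F] [Module ℂ F]
    (h1 : Module.finrank ℂ F = 1) {l : F} (hl : l ≠ 0) (w : F) : ∃ c : ℂ, w = c • l := by
  obtain ⟨c, hc⟩ := (finrank_eq_one_iff_of_nonzero' l hl).1 h1 w
  exact ⟨c, hc.symm⟩

/-- Tensoring with a generator of a line is injective. -/
theorem tmul_right_injective {E F : Type*} [AddCommGroup E] [Module ℂ E]
    [AddCommGroup F] [Module ℂ F] {l : F} (hl : l ≠ 0) :
    Function.Injective fun v : E => v ⊗ₜ[ℂ] l := by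
  obtain ⟨φ, hφ⟩ : ∃ φ : Module.Dual ℂ F, φ l ≠ 0 := by
    by_contra! h
    exact hl ((Module.forall_dual_apply_eq_zero_iff ℂ l).1 h)
  intro v w h
  have := congrArg (fun t => TensorProduct.rid ℂ E (φ.lTensor E t)) h
  exact smul_right_injective E hφ (by simpa using this)

theorem chart_injOn {c x y : X} (hx : x ∈ (chartAt ℂ c).source) (hy : y ∈ (chartAt ℂ c).source)
    (h : chartAt ℂ c x = chartAt ℂ c y) : x = y := (chartAt ℂ c).injOn hx hy h

theorem contMDiffAt_chart {x y : X} (hy : y ∈ (chartAt ℂ x).source) :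
    ContMDiffAt 𝓘(ℂ) 𝓘(ℂ) ω (chartAt ℂ x) y :=
  contMDiffAt_of_mem_maximalAtlas (IsManifold.chart_mem_maximalAtlas x) hy

theorem AnalyticAt.contMDiffAt_comp_chart {F : Type*} [NormedAddCommGroup F]
    [NormedSpace ℂ F] [CompleteSpace F] {f : ℂ → F} {x : X}
    (hf : AnalyticAt ℂ f (chartAt ℂ x x)) :
    ContMDiffAt 𝓘(ℂ) 𝓘(ℂ, F) ω (fun y => f (chartAt ℂ x y)) x :=
  (hf.contDiffAt (n := ω)).contMDiffAt.comp x (contMDiffAt_chart (mem_chart_source ℂ x))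

theorem eventually_comp_chart {p : ℂ → Prop} {x : X} (h : ∀ᶠ z in 𝓝 (chartAt ℂ x x), p z) :
    ∀ᶠ y in 𝓝 x, p (chartAt ℂ x y) :=
  ((chartAt ℂ x).continuousAt (mem_chart_source ℂ x)).eventually h

variable {r r' : ℕ} {V : HolVB.{u, v₁} X r} {W : HolVB.{u, v₂} X r'} {L : HolVB.{u, v₃} X 1}

theorem HolVB.exists_line_frame (L : HolVB.{u, v₃} X 1) (x : X) :
    ∃ l : ∀ y, L.Fiber y, L.HolAt x l ∧ l x ≠ 0 := by
  refine ⟨fun y => L.uncoord x y 1, holAt_uncoord (L.mem_base x) contMDiffAt_const, fun h => ?_⟩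
  have := HolVB.coord_uncoord (L.mem_base x) 1
  change L.uncoord x x 1 = 0 at h
  rw [h, map_zero] at this
  exact one_ne_zero this.symm

theorem HolVB.HolAt.eventually_ne_zero {V : HolVB.{u, v₁} X r} {x : X} {l : ∀ y, V.Fiber y}
    (hl : V.HolAt x l) (h0 : l x ≠ 0) : ∀ᶠ y in 𝓝 x, l y ≠ 0 := by
  have := HolVB.eventually_linearIndependent (ι := Unit) (e := fun _ => l) (fun _ => hl)
    (LinearIndependent.of_subsingleton () h0)
  filter_upwards [this] with y hy
  exact hy.ne_zero ()

theorem HolVB.HolAt.exists_smul_line {x : X} {l l' : ∀ y, L.Fiber y} (hl : L.HolAt x l)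
    (h0 : l x ≠ 0) (hl' : L.HolAt x l') :
    ∃ c : X → ℂ, ContMDiffAt 𝓘(ℂ) 𝓘(ℂ) ω c x ∧ ∀ᶠ y in 𝓝 x, l' y = c y • l y := by
  obtain ⟨c, hc, h⟩ := HolVB.exists_holomorphic_coeff (ι := Unit) (e := fun _ => l)
    (fun _ => hl) (LinearIndependent.of_subsingleton () h0) hl' (by
      filter_upwards [hl.eventually_ne_zero h0] with y hy
      obtain ⟨c, hc⟩ := exists_smul_of_rank_one (L.finrank_fiber y) hy (l' y)
      rw [hc]
      exact Submodule.smul_mem _ _ (Submodule.subset_span ⟨(), rfl⟩))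
  exact ⟨c (), hc (), by simpa using h⟩

namespace TwistedMap

/-- In terms of a local frame of the line bundle, a twisted map takes holomorphic sections to
holomorphic sections. -/
theorem exists_apply_eq_tmul (f : TwistedMap V W L) {x : X} {l : ∀ y, L.Fiber y}
    (hl : L.HolAt x l) (h0 : l x ≠ 0) {s : ∀ y, V.Fiber y} (hs : V.HolAt x s) :
    ∃ t : ∀ y, W.Fiber y, W.HolAt x t ∧ ∀ᶠ y in 𝓝 x, f.toFun y (s y) = t y ⊗ₜ[ℂ] l y := by
  obtain ⟨U, hU, hx, hsU⟩ := hs.exists_isHolOn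
  obtain ⟨U', hU', hx', -, t, l', ht, hl', h⟩ := f.holomorphic U s hU hsU x hx
  obtain ⟨c, hc, hcl⟩ := hl.exists_smul_line h0 (hl'.holAt hU' hx')
  refine ⟨fun y => c y • t y, HolVB.HolAt.smul hc (ht.holAt hU' hx'), ?_⟩
  filter_upwards [hU'.mem_nhds hx', hcl] with y hy hyc
  rw [show f.toFun y (s y) = _ from h y hy, hyc, TensorProduct.tmul_smul, TensorProduct.smul_tmul']

/-- Local frames near `x` in which a twisted map is diagonal with monomial entries. -/
structure LocalForm (f : TwistedMap V W L) (x : X) where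
  (n m k : ℕ)
  domain_rank : n + m = r
  codomain_rank : m + k = r'
  U : Set X
  isOpen : IsOpen U
  mem : x ∈ U
  subset_source : U ⊆ (chartAt ℂ x).source
  e : Fin n ⊕ Fin m → ∀ y, V.Fiber y
  g : Fin m ⊕ Fin k → ∀ y, W.Fiber y
  l : ∀ y, L.Fiber y
  d : Fin m → ℕ
  holAt_e : ∀ i, ∀ y ∈ U, V.HolAt y (e i)
  holAt_g : ∀ i, ∀ y ∈ U, W.HolAt y (g i)
  holAt_l : ∀ y ∈ U, L.HolAt y l
  li_e : ∀ y ∈ U, LinearIndependent ℂ fun i => e i y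
  li_g : ∀ y ∈ U, LinearIndependent ℂ fun i => g i y
  l_ne_zero : ∀ y ∈ U, l y ≠ 0
  map_inl : ∀ y ∈ U, ∀ i, f.toFun y (e (Sum.inl i) y) = 0
  map_inr : ∀ y ∈ U, ∀ i, f.toFun y (e (Sum.inr i) y) =
    (chartAt ℂ x y - chartAt ℂ x x) ^ d i • (g (Sum.inl i) y ⊗ₜ[ℂ] l y)

/-- With V and W trivialized and a generator l of L chosen near x, f is a matrix B of holomorphic
functions of the chart coordinate. Its Smith normal form supplies the frames, and all required
properties are open conditions. -/
theorem nonempty_localForm (f : TwistedMap V W L) (x : X) : Nonempty (f.LocalForm x) := by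
  obtain ⟨l, hl, hl0⟩ := L.exists_line_frame x
  have hxV := V.mem_base x
  have hxW := W.mem_base x
  have hxs := mem_chart_source ℂ x
  set φ := chartAt ℂ x with hφ
  choose t ht htf using fun j : Fin r => f.exists_apply_eq_tmul hl hl0
    (HolVB.holAt_uncoord (V := V) hxV (contMDiffAt_const (c := Pi.single j (1 : ℂ))))
  let B : ℂ → Matrix (Fin r') (Fin r) ℂ := fun z => Matrix.of fun i j =>
    W.coord x (φ.symm z) (t j (φ.symm z)) i
  have hB : ∀ i j, AnalyticAt ℂ (fun z => B z i j) (φ x) := by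
    intro i j
    have h1 := (HolVB.holAt_iff hxW).1 (ht j)
    exact (contMDiffAt_pi_space.1 h1 i).analyticAt_comp_chart_symm hxs
  obtain ⟨n, m, k, hr, hr', P, Q, d, hP, hQ, hPl, hQl, hPB, hQB⟩ := exists_analytic_smith B hB
  let e : Fin n ⊕ Fin m → ∀ y, V.Fiber y := fun i y => V.uncoord x y fun j => P i j (φ y)
  let g : Fin m ⊕ Fin k → ∀ y, W.Fiber y := fun i y => W.uncoord x y fun j => Q i j (φ y)
  have he : ∀ i, V.HolAt x (e i) := fun i => HolVB.holAt_uncoord hxV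
    (contMDiffAt_pi_space.2 fun j => (hP i j).contMDiffAt_comp_chart)
  have hg : ∀ i, W.HolAt x (g i) := fun i => HolVB.holAt_uncoord hxW
    (contMDiffAt_pi_space.2 fun j => (hQ i j).contMDiffAt_comp_chart)
  have hel : LinearIndependent ℂ fun i => e i x := by
    rw [← HolVB.linearIndependent_coord_iff hxV]
    simpa only [e, HolVB.coord_uncoord hxV] using hPl
  have hgl : LinearIndependent ℂ fun i => g i x := by
    rw [← HolVB.linearIndependent_coord_iff hxW]
    simpa only [g, HolVB.coord_uncoord hxW] using hQl
  have hf : ∀ᶠ y in 𝓝 x, ∀ v : Fin r → ℂ, f.toFun y (V.uncoord x y v) =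
      W.uncoord x y ((B (φ y)).mulVec v) ⊗ₜ[ℂ] l y := by
    filter_upwards [eventually_all.2 htf, (W.isOpen_base x).mem_nhds hxW,
      φ.open_source.mem_nhds hxs] with y hy hyW hys v
    have h1 : (B (φ y)).mulVec v = ∑ j, v j • W.coord x y (t j y) := by
      -- The value of t j at φ.symm (φ y) lies in a fibre that is only propositionally the fibre at
      -- y; a variable base point avoids rewriting inside a dependent type.
      have hw : ∀ w, w = y → ∀ i j, W.coord x w (t j w) i = W.coord x y (t j y) i := by
        rintro _ rfl _ _; rfl
      funext i
      simp only [B, hw _ (φ.left_inv hys), Matrix.mulVec, dotProduct, Matrix.of_apply,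
        Finset.sum_apply, Pi.smul_apply, smul_eq_mul, mul_comm]
    have h2 : V.uncoord x y v = ∑ j, v j • V.uncoord x y (Pi.single j 1) := by
      conv_lhs => rw [← Finset.univ_sum_single v, map_sum]
      refine Finset.sum_congr rfl fun j _ => ?_
      rw [← map_smul, ← Pi.single_smul, smul_eq_mul, mul_one]
    rw [h1, h2, map_sum, map_sum, TensorProduct.sum_tmul]
    refine Finset.sum_congr rfl fun j _ => ?_
    rw [map_smul, map_smul, hy j, HolVB.uncoord_coord hyW, TensorProduct.smul_tmul']
  have hall : ∀ᶠ y in 𝓝 x, y ∈ φ.source ∧ (∀ i, V.HolAt y (e i)) ∧ (∀ i, W.HolAt y (g i)) ∧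
      L.HolAt y l ∧ (LinearIndependent ℂ fun i => e i y) ∧ (LinearIndependent ℂ fun i => g i y) ∧
      l y ≠ 0 ∧ (∀ i, f.toFun y (e (Sum.inl i) y) = 0) ∧
      (∀ i, f.toFun y (e (Sum.inr i) y) =
        (φ y - φ x) ^ d i • (g (Sum.inl i) y ⊗ₜ[ℂ] l y)) := by
    filter_upwards [φ.open_source.mem_nhds hxs, eventually_all.2 fun i => (he i).eventually,
      eventually_all.2 fun i => (hg i).eventually, hl.eventually,
      HolVB.eventually_linearIndependent he hel, HolVB.eventually_linearIndependent hg hgl,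
      hl.eventually_ne_zero hl0, hf, eventually_comp_chart hPB, eventually_comp_chart hQB]
      with y h1 h2 h3 h4 h5 h6 h7 h8 h9 h10
    refine ⟨h1, h2, h3, h4, h5, h6, h7, fun i => ?_, fun i => ?_⟩
    · rw [h8, h9 i, map_zero, TensorProduct.zero_tmul]
    · rw [h8, h10 i, map_smul, TensorProduct.smul_tmul']
  obtain ⟨U, hU, hUo, hxU⟩ := eventually_nhds_iff.1 hall
  exact ⟨⟨n, m, k, hr, hr', U, hUo, hxU, fun y hy => (hU y hy).1, e, g, l, d,
    fun i y hy => (hU y hy).2.1 i, fun i y hy => (hU y hy).2.2.1 i,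
    fun y hy => (hU y hy).2.2.2.1, fun y hy => (hU y hy).2.2.2.2.1,
    fun y hy => (hU y hy).2.2.2.2.2.1, fun y hy => (hU y hy).2.2.2.2.2.2.1,
    fun y hy => (hU y hy).2.2.2.2.2.2.2.1, fun y hy => (hU y hy).2.2.2.2.2.2.2.2⟩⟩

end TwistedMap

end

/-! ### The kernel and the saturated image as subbundles. -/

noncomputable section

variable {X : Type u} [TopologicalSpace X] [ChartedSpace ℂ X] [IsManifold 𝓘(ℂ) ω X]
open Filter Topology Complex

theorem nhdsNE_neBot_of_chartedSpace {X : Type u} [TopologicalSpace X] [ChartedSpace ℂ X] (x : X) :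
    (𝓝[≠] x).NeBot := by
  rw [neBot_iff]
  intro h
  have h1 : ∀ᶠ y in 𝓝[≠] x, False := by rw [h]; exact eventually_bot
  rw [eventually_nhdsWithin_iff] at h1
  have hT := (chartAt ℂ x).map_source (mem_chart_source ℂ x)
  have h2 := (chartAt ℂ x).continuousAt_symm hT
  rw [ContinuousAt, (chartAt ℂ x).left_inv (mem_chart_source ℂ x)] at h2
  have h3 : ∀ᶠ z in 𝓝[≠] (chartAt ℂ x x), False := by
    rw [eventually_nhdsWithin_iff]
    filter_upwards [h2.eventually h1, (chartAt ℂ x).open_target.mem_nhds hT] with z hz hzT hne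
    refine hz fun h => hne ?_
    rw [mem_singleton_iff, ← (chartAt ℂ x).right_inv hzT, mem_singleton_iff.1 h]
  exact h3.exists.elim fun _ h => h

theorem eq_zero_of_eventually_nhdsNE {c : X → ℂ} {x : X} (hc : ContinuousAt c x)
    (h : ∀ᶠ y in 𝓝[≠] x, c y = 0) : c x = 0 := by
  have := nhdsNE_neBot_of_chartedSpace x
  have h1 : Tendsto c (𝓝[≠] x) (𝓝 0) := tendsto_const_nhds.congr' (h.mono fun y hy => hy.symm)
  exact tendsto_nhds_unique (hc.tendsto.mono_left nhdsWithin_le_nhds) h1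

theorem eventually_nhdsNE_ne [T2Space X] (x y : X) : ∀ᶠ z in 𝓝[≠] y, z ≠ x := by
  by_cases h : y = x
  · subst h; exact eventually_mem_nhdsWithin
  · exact (eventually_ne_nhds h).filter_mono nhdsWithin_le_nhds

variable {r r' : ℕ} {V : HolVB.{u, v₁} X r} {W : HolVB.{u, v₂} X r'} {L : HolVB.{u, v₃} X 1}

namespace TwistedMap

variable (f : TwistedMap V W L)

/-- The values at `x` of the local holomorphic sections of the kernel. -/
def kerCarrier (x : X) : Submodule ℂ (V.Fiber x) where
  carrier := {v | ∃ s, V.HolAt x s ∧ s x = v ∧ ∀ᶠ y in 𝓝 x, f.toFun y (s y) = 0}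
  add_mem' := by
    rintro _ _ ⟨s, hs, rfl, h⟩ ⟨s', hs', rfl, h'⟩
    refine ⟨_, hs.add hs', rfl, ?_⟩
    filter_upwards [h, h'] with y h1 h2
    rw [map_add, h1, h2, add_zero]
  zero_mem' := ⟨_, HolVB.holAt_zero, rfl, by simp⟩
  smul_mem' := by
    rintro c _ ⟨s, hs, rfl, h⟩
    refine ⟨_, HolVB.HolAt.smul (contMDiffAt_const (c := c)) hs, rfl, ?_⟩
    filter_upwards [h] with y h1
    rw [map_smul, h1, smul_zero]

/-- The values at `x` of the local holomorphic sections of the saturation of the image, twisted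
by the dual of the line bundle. -/
def imCarrier (x : X) : Submodule ℂ (W.Fiber x) where
  carrier := {w | ∃ t, W.HolAt x t ∧ t x = w ∧
    ∀ᶠ y in 𝓝[≠] x, ∀ l, t y ⊗ₜ[ℂ] l ∈ LinearMap.range (f.toFun y)}
  add_mem' := by
    rintro _ _ ⟨s, hs, rfl, h⟩ ⟨s', hs', rfl, h'⟩
    refine ⟨_, hs.add hs', rfl, ?_⟩
    filter_upwards [h, h'] with y h1 h2 l
    rw [TensorProduct.add_tmul]
    exact Submodule.add_mem _ (h1 l) (h2 l)
  zero_mem' := ⟨_, HolVB.holAt_zero, rfl, by simp⟩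
  smul_mem' := by
    rintro c _ ⟨s, hs, rfl, h⟩
    refine ⟨_, HolVB.HolAt.smul (contMDiffAt_const (c := c)) hs, rfl, ?_⟩
    filter_upwards [h] with y h1 l
    rw [← TensorProduct.smul_tmul']
    exact Submodule.smul_mem _ _ (h1 l)

theorem kerCarrier_le_ker (x : X) : f.kerCarrier x ≤ LinearMap.ker (f.toFun x) := by
  rintro _ ⟨s, -, rfl, h⟩
  exact h.self_of_nhds

variable {f}

namespace LocalForm

variable {x y : X} (F : f.LocalForm x)

/-- The diagonal entries of a twisted map in a local form. -/
def factor (j : Fin F.m) (y : X) : ℂ := (chartAt ℂ x y - chartAt ℂ x x) ^ F.d j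

theorem factor_ne_zero (hy : y ∈ F.U) (hne : y ≠ x) (j : Fin F.m) : F.factor j y ≠ 0 :=
  pow_ne_zero _ (sub_ne_zero.2 fun h =>
    hne (chart_injOn (F.subset_source hy) (mem_chart_source ℂ x) h))

theorem span_e (hy : y ∈ F.U) : Submodule.span ℂ (range fun i => F.e i y) = ⊤ :=
  HolVB.span_eq_top_of_linearIndependent (F.li_e y hy) (by simp [F.domain_rank])

theorem span_g (hy : y ∈ F.U) : Submodule.span ℂ (range fun i => F.g i y) = ⊤ :=
  HolVB.span_eq_top_of_linearIndependent (F.li_g y hy) (by simp [F.codomain_rank])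

theorem apply_sum (hy : y ∈ F.U) (a : Fin F.n ⊕ Fin F.m → ℂ) :
    f.toFun y (∑ i, a i • F.e i y) =
      (∑ j, (a (Sum.inr j) * F.factor j y) • F.g (Sum.inl j) y) ⊗ₜ[ℂ] F.l y := by
  rw [Fintype.sum_sum_type, map_add, map_sum, map_sum, TensorProduct.sum_tmul]
  simp only [map_smul, F.map_inl y hy, smul_zero, Finset.sum_const_zero, zero_add]
  refine Finset.sum_congr rfl fun j _ => ?_
  rw [F.map_inr y hy, smul_smul, TensorProduct.smul_tmul']
  rfl

theorem li_g_inl (hy : y ∈ F.U) : LinearIndependent ℂ fun j => F.g (Sum.inl j) y :=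
  (F.li_g y hy).comp _ Sum.inl_injective

theorem coeff_eq_zero_of_apply_eq_zero (hy : y ∈ F.U) (hne : y ≠ x)
    {a : Fin F.n ⊕ Fin F.m → ℂ} (h : f.toFun y (∑ i, a i • F.e i y) = 0) (j : Fin F.m) :
    a (Sum.inr j) = 0 := by
  rw [F.apply_sum hy] at h
  have h2 := tmul_right_injective (F.l_ne_zero y hy)
    (h.trans (TensorProduct.zero_tmul _ _).symm)
  have := Fintype.linearIndependent_iff.1 (F.li_g_inl hy) _ h2 j
  exact (mul_eq_zero.1 this).resolve_right (F.factor_ne_zero hy hne j)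

theorem exists_coeff_e (hy : y ∈ F.U) (v : V.Fiber y) :
    ∃ a : Fin F.n ⊕ Fin F.m → ℂ, v = ∑ i, a i • F.e i y := by
  have hv : v ∈ Submodule.span ℂ (range fun i => F.e i y) := by rw [F.span_e hy]; trivial
  obtain ⟨a, ha⟩ := (Submodule.mem_span_range_iff_exists_fun ℂ).1 hv
  exact ⟨a, ha.symm⟩

theorem mem_span_of_tmul_mem_range (hy : y ∈ F.U) {w : W.Fiber y}
    (hw : w ⊗ₜ[ℂ] F.l y ∈ LinearMap.range (f.toFun y)) :
    w ∈ Submodule.span ℂ (range fun j => F.g (Sum.inl j) y) := by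
  obtain ⟨v, hv⟩ := hw
  obtain ⟨a, rfl⟩ := F.exists_coeff_e hy v
  rw [F.apply_sum hy] at hv
  have : _ = w := tmul_right_injective (F.l_ne_zero y hy) hv
  rw [← this]
  exact Submodule.sum_mem _ fun j _ => Submodule.smul_mem _ _ (Submodule.subset_span ⟨j, rfl⟩)

theorem tmul_mem_range (hy : y ∈ F.U) (hne : y ≠ x) (j : Fin F.m) (l : L.Fiber y) :
    F.g (Sum.inl j) y ⊗ₜ[ℂ] l ∈ LinearMap.range (f.toFun y) := by
  obtain ⟨c, rfl⟩ := exists_smul_of_rank_one (L.finrank_fiber y) (F.l_ne_zero y hy) l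
  refine ⟨(c * (F.factor j y)⁻¹) • F.e (Sum.inr j) y, ?_⟩
  rw [map_smul, F.map_inr y hy, TensorProduct.tmul_smul, smul_smul, mul_assoc,
    show (F.factor j y)⁻¹ * (chartAt ℂ x y - chartAt ℂ x x) ^ F.d j = 1 from
      inv_mul_cancel₀ (F.factor_ne_zero hy hne j), mul_one]

variable [T2Space X]

theorem eventually_nhdsNE (hy : y ∈ F.U) : ∀ᶠ z in 𝓝[≠] y, z ∈ F.U ∧ z ≠ x :=
  Eventually.and (mem_nhdsWithin_of_mem_nhds (F.isOpen.mem_nhds hy)) (eventually_nhdsNE_ne x y)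

/-- A section of the kernel has zero coefficients on the complementary frame wherever the monomials
are nonzero, hence also at the centre by continuity. The description therefore holds at the centre,
where the fibrewise kernel may be larger. -/
theorem kerCarrier_eq (hy : y ∈ F.U) :
    f.kerCarrier y = Submodule.span ℂ (range fun i => F.e (Sum.inl i) y) := by
  apply le_antisymm
  · rintro _ ⟨s, hs, rfl, h⟩
    obtain ⟨c, hc, hcs⟩ := HolVB.exists_holomorphic_coeff (fun i => F.holAt_e i y hy)
      (F.li_e y hy) hs (by
        filter_upwards [F.isOpen.mem_nhds hy] with z hz
        rw [F.span_e hz]; trivial)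
    have h0 : ∀ j, c (Sum.inr j) y = 0 := fun j => by
      refine eq_zero_of_eventually_nhdsNE (hc _).continuousAt ?_
      filter_upwards [F.eventually_nhdsNE hy, h.filter_mono nhdsWithin_le_nhds,
        hcs.filter_mono nhdsWithin_le_nhds] with z hz hfz hcz
      rw [hcz] at hfz
      exact F.coeff_eq_zero_of_apply_eq_zero hz.1 hz.2 (a := fun i => c i z) hfz j
    rw [hcs.self_of_nhds, Fintype.sum_sum_type]
    simp only [h0, zero_smul, Finset.sum_const_zero, add_zero]
    exact Submodule.sum_mem _ fun j _ => Submodule.smul_mem _ _ (Submodule.subset_span ⟨j, rfl⟩)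
  · rw [Submodule.span_le]
    rintro _ ⟨i, rfl⟩
    refine ⟨F.e (Sum.inl i), F.holAt_e _ y hy, rfl, ?_⟩
    filter_upwards [F.isOpen.mem_nhds hy] with z hz
    exact F.map_inl z hz i

/-- Membership in the image is required only on a punctured neighbourhood, so the monomial factors
can be divided out; continuity of coefficients gives the converse at the centre. -/
theorem imCarrier_eq (hy : y ∈ F.U) :
    f.imCarrier y = Submodule.span ℂ (range fun i => F.g (Sum.inl i) y) := by
  apply le_antisymm
  · rintro _ ⟨t, ht, rfl, h⟩
    obtain ⟨c, hc, hct⟩ := HolVB.exists_holomorphic_coeff (fun i => F.holAt_g i y hy)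
      (F.li_g y hy) ht (by
        filter_upwards [F.isOpen.mem_nhds hy] with z hz
        rw [F.span_g hz]; trivial)
    have h0 : ∀ j, c (Sum.inr j) y = 0 := fun j => by
      refine eq_zero_of_eventually_nhdsNE (hc _).continuousAt ?_
      filter_upwards [F.eventually_nhdsNE hy, h,
        hct.filter_mono nhdsWithin_le_nhds] with z hz hfz hcz
      obtain ⟨a, ha⟩ := (Submodule.mem_span_range_iff_exists_fun ℂ).1
        (F.mem_span_of_tmul_mem_range hz.1 (hfz (F.l z)))
      have h1 : ∑ i, (c i z - Sum.elim a 0 i) • F.g i z = 0 := by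
        simp only [sub_smul, Finset.sum_sub_distrib]
        rw [← hcz, Fintype.sum_sum_type]
        simp [ha]
      simpa using Fintype.linearIndependent_iff.1 (F.li_g z hz.1) _ h1 (Sum.inr j)
    rw [hct.self_of_nhds, Fintype.sum_sum_type]
    simp only [h0, zero_smul, Finset.sum_const_zero, add_zero]
    exact Submodule.sum_mem _ fun j _ => Submodule.smul_mem _ _ (Submodule.subset_span ⟨j, rfl⟩)
  · rw [Submodule.span_le]
    rintro _ ⟨i, rfl⟩
    refine ⟨F.g (Sum.inl i), F.holAt_g _ y hy, rfl, ?_⟩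
    filter_upwards [F.eventually_nhdsNE hy] with z hz l
    exact F.tmul_mem_range hz.1 hz.2 i l

theorem finrank_kerCarrier (hy : y ∈ F.U) : Module.finrank ℂ (f.kerCarrier y) = F.n := by
  rw [F.kerCarrier_eq hy]
  exact (finrank_span_eq_card ((F.li_e y hy).comp _ Sum.inl_injective)).trans (by simp)

theorem ker_eq_kerCarrier (hy : y ∈ F.U) (hne : y ≠ x) :
    LinearMap.ker (f.toFun y) = f.kerCarrier y := by
  refine le_antisymm (fun v hv => ?_) (f.kerCarrier_le_ker y)
  obtain ⟨a, rfl⟩ := F.exists_coeff_e hy v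
  have h0 := F.coeff_eq_zero_of_apply_eq_zero hy hne hv
  rw [Fintype.sum_sum_type, F.kerCarrier_eq hy]
  simp only [h0, zero_smul, Finset.sum_const_zero, add_zero]
  exact Submodule.sum_mem _ fun j _ => Submodule.smul_mem _ _ (Submodule.subset_span ⟨j, rfl⟩)

end LocalForm

variable (f)

/-- A choice of local form at each point. -/
def localForm (x : X) : f.LocalForm x := Classical.choice (f.nonempty_localForm x)

variable [T2Space X] [ConnectedSpace X]

/-- By the local forms this dimension is locally constant, hence constant. It is at most the
dimension of every fibrewise kernel, with equality off the centre of a local form, so it is the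
infimum defining `kerRank`. -/
theorem finrank_kerCarrier_eq_kerRank (x : X) :
    Module.finrank ℂ (f.kerCarrier x) = f.kerRank := by
  have hconst : ∀ y, Module.finrank ℂ (f.kerCarrier y) = Module.finrank ℂ (f.kerCarrier x) := by
    have hlc : IsLocallyConstant fun y => Module.finrank ℂ (f.kerCarrier y) := by
      rw [IsLocallyConstant.iff_eventually_eq]
      intro y
      filter_upwards [(f.localForm y).isOpen.mem_nhds (f.localForm y).mem] with z hz
      rw [(f.localForm y).finrank_kerCarrier hz,
        (f.localForm y).finrank_kerCarrier (f.localForm y).mem]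
    exact fun y => hlc.apply_eq_of_isPreconnected isPreconnected_univ (mem_univ y) (mem_univ x)
  have := nhdsNE_neBot_of_chartedSpace x
  obtain ⟨y, hyU, hne⟩ := ((f.localForm x).eventually_nhdsNE (f.localForm x).mem).exists
  apply le_antisymm
  · refine le_ciInf fun z => ?_
    rw [← hconst z]
    exact Submodule.finrank_mono (f.kerCarrier_le_ker z)
  · refine (ciInf_le (OrderBot.bddBelow _) y).trans ?_
    rw [(f.localForm x).ker_eq_kerCarrier hyU hne, hconst]

theorem LocalForm.n_eq {f : TwistedMap V W L} {x : X} (F : f.LocalForm x) : F.n = f.kerRank := by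
  rw [← f.finrank_kerCarrier_eq_kerRank x, F.finrank_kerCarrier F.mem]

theorem LocalForm.m_eq {f : TwistedMap V W L} {x : X} (F : f.LocalForm x) :
    F.m = r - f.kerRank := by
  have := F.domain_rank
  rw [← F.n_eq]; omega

theorem kerRank_le : f.kerRank ≤ r := by
  obtain ⟨x⟩ : Nonempty X := inferInstance
  have F := f.localForm x
  have := F.domain_rank
  rw [← F.n_eq]; omega

/-- The kernel as a subbundle. -/
def kerSub : V.Sub where
  carrier := f.kerCarrier
  rank := f.kerRank
  exists_frame x := by
    let F := f.localForm x
    refine ⟨F.U, F.isOpen, F.mem, fun i => F.e (Sum.inl (Fin.cast F.n_eq.symm i)),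
      fun i => HolVB.isHolOn_of_holAt fun y hy => F.holAt_e _ y hy, fun y hy => ⟨?_, ?_⟩⟩
    · exact (F.li_e y hy).comp _ (Sum.inl_injective.comp (Fin.cast_injective _))
    · rw [F.kerCarrier_eq hy]
      congr 1
      exact (finCongr F.n_eq.symm).surjective.range_comp fun i => F.e (Sum.inl i) y

/-- The saturation of the image, twisted by the dual of the line bundle, as a subbundle. -/
def imSub : W.Sub where
  carrier := f.imCarrier
  rank := r - f.kerRank
  exists_frame x := by
    let F := f.localForm x
    refine ⟨F.U, F.isOpen, F.mem, fun i => F.g (Sum.inl (Fin.cast F.m_eq.symm i)),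
      fun i => HolVB.isHolOn_of_holAt fun y hy => F.holAt_g _ y hy, fun y hy => ⟨?_, ?_⟩⟩
    · exact (F.li_g y hy).comp _ (Sum.inl_injective.comp (Fin.cast_injective _))
    · rw [F.imCarrier_eq hy]
      congr 1
      exact (finCongr F.m_eq.symm).surjective.range_comp fun i => F.g (Sum.inl i) y

theorem mapsTo_kerSub (T : W.Sub) : f.MapsTo f.kerSub T := by
  intro x v hv
  rw [show f.toFun x v = 0 from f.kerCarrier_le_ker x hv]
  exact Submodule.zero_mem _

theorem mapsTo_imSub (S : V.Sub) : f.MapsTo S f.imSub := by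
  intro x v _
  let F := f.localForm x
  obtain ⟨a, rfl⟩ := F.exists_coeff_e F.mem v
  rw [F.apply_sum F.mem]
  have hw : ∑ j, (a (Sum.inr j) * F.factor j x) • F.g (Sum.inl j) x ∈ f.imCarrier x := by
    rw [F.imCarrier_eq F.mem]
    exact Submodule.sum_mem _ fun j _ => Submodule.smul_mem _ _ (Submodule.subset_span ⟨j, rfl⟩)
  exact ⟨⟨_, hw⟩ ⊗ₜ F.l x, rfl⟩

theorem injective_of_kerRank_eq_zero (h : f.kerRank = 0) : f.Injective := by
  intro U s hU hs h0 x hx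
  have hmem : s x ∈ f.kerCarrier x := by
    refine ⟨s, hs.holAt hU hx, rfl, ?_⟩
    filter_upwards [hU.mem_nhds hx] with y hy
    exact h0 y hy
  have hbot : f.kerCarrier x = ⊥ := by
    rw [← Submodule.finrank_eq_zero (R := ℂ), f.finrank_kerCarrier_eq_kerRank, h]
  rw [hbot] at hmem
  exact hmem

theorem isZero_of_kerRank_eq (h : f.kerRank = r) : f.IsZero := by
  intro x
  have htop : f.kerCarrier x = ⊤ := by
    apply Submodule.eq_top_of_finrank_eq
    rw [f.finrank_kerCarrier_eq_kerRank, h, V.finrank_fiber]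
  ext v
  have hv : v ∈ f.kerCarrier x := by rw [htop]; trivial
  exact f.kerCarrier_le_ker x hv

end TwistedMap

theorem TwistedMap.mapsTo_top (f : TwistedMap V W L) (S : V.Sub) : f.MapsTo S W.top := by
  intro x v _
  have : Function.Surjective ((W.top.carrier x).subtype.rTensor (L.Fiber x)) :=
    LinearMap.rTensor_surjective _ fun w => ⟨⟨w, trivial⟩, rfl⟩
  exact this _

/-- The zero subbundle. -/
def HolVB.bot (V : HolVB.{u, v₁} X r) : V.Sub where
  carrier _ := ⊥
  rank := 0
  exists_frame x := ⟨univ, isOpen_univ, mem_univ x, fun i => i.elim0, fun i => i.elim0,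
    fun y _ => ⟨linearIndependent_empty_type, by simp⟩⟩

theorem TwistedMap.bot_mapsTo (f : TwistedMap V W L) (T : W.Sub) : f.MapsTo V.bot T := by
  intro x v hv
  rw [(Submodule.mem_bot ℂ).1 hv, map_zero]
  exact Submodule.zero_mem _

end

/-! ### Gram determinants and frame independence of the Chern density. -/

noncomputable section

variable {X : Type u} [TopologicalSpace X] [ChartedSpace ℂ X] [IsManifold 𝓘(ℂ) ω X]
open Filter Topology Complex

namespace HolVB

variable {r : ℕ} {V : HolVB.{u, v} X r}

namespace HermitianMetric

variable (h : V.HermitianMetric) {ι κ : Type*} [Fintype ι] [DecidableEq ι] [Fintype κ]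
  [DecidableEq κ] {x : X}

/-- The Gram matrix of a family of vectors in a fibre. -/
def gram (s : ι → V.Fiber x) : Matrix ι ι ℂ := Matrix.of fun i j => h.form x (s i) (s j)

/-- The determinant of the Gram matrix of a family of vectors in a fibre. -/
def gramDet (s : ι → V.Fiber x) : ℝ := (h.gram s).det.re

theorem isHermitian_gram (s : ι → V.Fiber x) : (h.gram s).IsHermitian := by
  ext i j
  simp [gram, h.conj_symm]

open scoped ComplexOrder in
theorem posDef_gram {s : ι → V.Fiber x} (hs : LinearIndependent ℂ s) : (h.gram s).PosDef := by
  refine Matrix.PosDef.of_dotProduct_mulVec_pos (h.isHermitian_gram s) fun c hc => ?_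
  have e : star c ⬝ᵥ (h.gram s).mulVec c =
      h.form x (∑ i, c i • s i) (∑ i, c i • s i) := by
    simp only [map_sum, LinearMap.map_smulₛₗ, LinearMap.sum_apply, LinearMap.smul_apply,
      map_smul, dotProduct, Matrix.mulVec, gram, Matrix.of_apply, Finset.mul_sum, smul_eq_mul,
      Pi.star_apply]
    rw [Finset.sum_comm]
    refine Finset.sum_congr rfl fun i _ => Finset.sum_congr rfl fun j _ => ?_
    simp only [RCLike.star_def]
    ring
  have hne : ∑ i, c i • s i ≠ 0 := fun h0 =>
    hc (funext (Fintype.linearIndependent_iff.1 hs c h0))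
  rw [e, Complex.pos_iff]
  refine ⟨h.pos x _ hne, ?_⟩
  have := congrArg Complex.im (h.conj_symm x (∑ i, c i • s i) (∑ i, c i • s i))
  simp only [Complex.conj_im] at this
  linarith

open scoped ComplexOrder in
theorem gramDet_pos {s : ι → V.Fiber x} (hs : LinearIndependent ℂ s) : 0 < h.gramDet s :=
  (Complex.pos_iff.1 (h.posDef_gram hs).det_pos).1

/-- The Gram matrix G becomes P* G P. Changes of frame therefore alter log det G by log |det P|²,
which is harmonic when P is holomorphic and invertible. -/
theorem gramDet_sum_smul (s : ι → V.Fiber x) (P : Matrix ι ι ℂ) :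
    h.gramDet (fun j => ∑ i, P i j • s i) = normSq P.det * h.gramDet s := by
  have e : h.gram (fun j => ∑ i, P i j • s i) = P.conjTranspose * h.gram s * P := by
    ext i j
    simp only [gram, Matrix.of_apply, map_sum, LinearMap.map_smulₛₗ, LinearMap.sum_apply,
      LinearMap.smul_apply, map_smul, smul_eq_mul, Matrix.mul_apply, Finset.sum_mul,
      Matrix.conjTranspose_apply]
    refine Finset.sum_congr rfl fun a _ => ?_
    rw [Finset.mul_sum]
    refine Finset.sum_congr rfl fun b _ => ?_
    simp only [RCLike.star_def]
    ring
  rw [gramDet, e, Matrix.det_mul, Matrix.det_mul, Matrix.det_conjTranspose, gramDet,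
    ← Complex.re_ofReal_mul, Complex.normSq_eq_conj_mul_self]
  congr 1
  simp only [RCLike.star_def]
  ring

theorem gramDet_comp_equiv (s : ι → V.Fiber x) (ε : κ ≃ ι) :
    h.gramDet (fun k => s (ε k)) = h.gramDet s := by
  have : h.gram (fun k => s (ε k)) = (h.gram s).submatrix ε ε := rfl
  rw [gramDet, this, Matrix.det_submatrix_equiv_self, gramDet]

theorem gramDet_smul (s : ι → V.Fiber x) (a : ι → ℂ) :
    h.gramDet (fun i => a i • s i) = normSq (∏ i, a i) * h.gramDet s := by
  rw [← Matrix.det_diagonal, ← gramDet_sum_smul]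
  congr 1
  funext j
  simp [Matrix.diagonal_apply]

theorem gramDet_nonneg (s : ι → V.Fiber x) : 0 ≤ h.gramDet s := by
  by_cases hs : LinearIndependent ℂ s
  · exact (h.gramDet_pos hs).le
  · rw [Fintype.linearIndependent_iff] at hs
    push Not at hs
    obtain ⟨c, hc, i, hi⟩ := hs
    have : (h.gram s).det = 0 := by
      refine Matrix.exists_mulVec_eq_zero_iff.1 ⟨c, fun h0 => hi (by simp [h0]), ?_⟩
      funext j
      have := congrArg (h.form x (s j)) hc
      simpa [gram, Matrix.mulVec, dotProduct, mul_comm] using this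
    rw [gramDet, this]; simp

theorem contMDiffAt_gramDet {s : ι → ∀ y, V.Fiber y} (hs : ∀ i, V.HolAt x (s i)) :
    ContMDiffAt 𝓘(ℝ, ℂ) 𝓘(ℝ, ℝ) ∞ (fun y => h.gramDet fun i => s i y) x := by
  have hent : ∀ i j, ContMDiffAt 𝓘(ℝ, ℂ) 𝓘(ℝ, ℂ) ∞ (fun y => h.form y (s i y) (s j y)) x := by
    intro i j
    obtain ⟨U, hU, hUo, hx⟩ := eventually_nhds_iff.1 ((hs i).eventually.and (hs j).eventually)
    exact (h.smooth U (s i) (s j) hUo (isHolOn_of_holAt fun y hy => (hU y hy).1)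
      (isHolOn_of_holAt fun y hy => (hU y hy).2)).contMDiffAt (hUo.mem_nhds hx)
  have hdet := (contDiff_matrix_det (𝕜 := ℝ) (A := ℂ) (ι := ι) (n := ∞)).contMDiff.contMDiffAt.comp
    x (contMDiffAt_pi_space.2 fun i => contMDiffAt_pi_space.2 fun j => hent i j)
  exact (Complex.reCLM.contDiff (n := ∞)).contMDiff.contMDiffAt.comp x hdet

end HermitianMetric

variable {ι : Type*} [Fintype ι] [DecidableEq ι]

/-- `s` is a holomorphic frame of the subbundle `S` near `x`. -/
structure Sub.IsFrameAt (S : V.Sub) (x : X) (s : ι → ∀ y, V.Fiber y) : Prop where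
  card : Fintype.card ι = S.rank
  holAt : ∀ i, V.HolAt x (s i)
  li : LinearIndependent ℂ fun i => s i x
  span : ∀ᶠ y in 𝓝 x, Submodule.span ℂ (range fun i => s i y) = S.carrier y

theorem Sub.IsFrameAt.eventually {S : V.Sub} {x : X} {s : ι → ∀ y, V.Fiber y}
    (h : S.IsFrameAt x s) : ∀ᶠ y in 𝓝 x, S.IsFrameAt y s := by
  filter_upwards [eventually_all.2 fun i => (h.holAt i).eventually,
    eventually_linearIndependent h.holAt h.li, eventually_eventually_nhds.2 h.span] with y h1 h2 h3
  exact ⟨h.card, h1, h2, h3⟩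

theorem Sub.isFrameAt_frame (S : V.Sub) (x : X) : S.IsFrameAt x (S.frame x) := by
  have h1 := (S.exists_frame x).choose_spec.1
  have h2 := (S.exists_frame x).choose_spec.2.1
  have h3 := (S.exists_frame x).choose_spec.2.2.choose_spec
  refine ⟨by simp, fun i => (h3.1 i).holAt h1 h2, (h3.2 x h2).1, ?_⟩
  filter_upwards [h1.mem_nhds h2] with y hy
  exact (h3.2 y hy).2

theorem isFrameAt_top {x : X} {s : ι → ∀ y, V.Fiber y} (hc : Fintype.card ι = r)
    (hs : ∀ i, V.HolAt x (s i)) (hli : LinearIndependent ℂ fun i => s i x) :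
    V.top.IsFrameAt x s := by
  refine ⟨hc, hs, hli, ?_⟩
  filter_upwards [eventually_linearIndependent hs hli] with y hy
  exact span_eq_top_of_linearIndependent hy hc

namespace HermitianMetric

variable (h : V.HermitianMetric)

theorem contDiffAt_log_gramDet {s : ι → ∀ y, V.Fiber y} {c : X} {z : ℂ}
    (hz : z ∈ (chartAt ℂ c).target) (hs : ∀ i, V.HolAt ((chartAt ℂ c).symm z) (s i))
    (hli : LinearIndependent ℂ fun i => s i ((chartAt ℂ c).symm z)) :
    ContDiffAt ℝ ∞ (fun w => Real.log (h.gramDet fun i => s i ((chartAt ℂ c).symm w))) z := by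
  have := (h.contMDiffAt_gramDet hs).contDiffAt_comp_chart_symm ((chartAt ℂ c).map_target hz)
  rw [(chartAt ℂ c).right_inv hz] at this
  exact this.log (h.gramDet_pos hli).ne'

end HermitianMetric

/-- The Chern form can be computed in any holomorphic frame. -/
theorem Sub.chernDensity_eq {S : V.Sub} (h : V.HermitianMetric) {c : X} {z : ℂ}
    (hz : z ∈ (chartAt ℂ c).target) {s : ι → ∀ y, V.Fiber y}
    (hs : S.IsFrameAt ((chartAt ℂ c).symm z) s) :
    S.chernDensity h c z = -(1 / (4 * Real.pi)) * Laplacian.laplacian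
      (fun w => Real.log (h.gramDet fun i => s i ((chartAt ℂ c).symm w))) z := by
  set φ := chartAt ℂ c with hφ
  set x := φ.symm z with hx
  have ht := S.isFrameAt_frame x
  set t := S.frame x with htdef
  let ε : Fin S.rank ≃ ι := (Fintype.equivFinOfCardEq hs.card).symm
  choose P hP hPs using fun j : Fin S.rank => exists_holomorphic_coeff hs.holAt hs.li (ht.holAt j)
    (by
      filter_upwards [hs.span, ht.span] with y h1 h2
      rw [h1, ← h2]
      exact Submodule.subset_span ⟨j, rfl⟩)
  let M : X → Matrix (Fin S.rank) (Fin S.rank) ℂ := fun y => Matrix.of fun i j => P j (ε i) y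
  have hdet : ContMDiffAt 𝓘(ℂ) 𝓘(ℂ) ω (fun y => (M y).det) x :=
    (contDiff_matrix_det (𝕜 := ℂ) (A := ℂ)).contMDiff.contMDiffAt.comp x
      (contMDiffAt_pi_space.2 fun i => contMDiffAt_pi_space.2 fun j => hP j (ε i))
  have hgram : ∀ᶠ y in 𝓝 x, h.gramDet (fun j => t j y) =
      normSq (M y).det * h.gramDet fun i => s i y := by
    filter_upwards [eventually_all.2 hPs] with y hy
    rw [← h.gramDet_comp_equiv (fun i => s i y) ε, ← h.gramDet_sum_smul]
    congr 1
    funext j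
    rw [hy j, ← Equiv.sum_comp ε]
    rfl
  -- Both families are frames, so both Gram determinants are positive and the factor between them
  -- cannot vanish.
  have hdet0 : (M x).det ≠ 0 := by
    intro h0
    have h1 := hgram.self_of_nhds
    rw [h0, map_zero, zero_mul] at h1
    exact (h.gramDet_pos ht.li).ne' h1
  have hana : AnalyticAt ℂ (fun w => (M (φ.symm w)).det) z := by
    have := hdet.analyticAt_comp_chart_symm (c := c) (φ.map_target hz)
    rwa [← hφ, hx, φ.right_inv hz] at this
  -- The logarithm of the norm of a nonvanishing holomorphic function is harmonic, so the change of
  -- frame drops out of the Laplacian.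
  have hharm := hana.harmonicAt_log_norm hdet0
  have hlog : (fun w => h.logGram t (φ.symm w)) =ᶠ[𝓝 z]
      (2 : ℝ) • (fun w => Real.log ‖(M (φ.symm w)).det‖) +
        fun w => Real.log (h.gramDet fun i => s i (φ.symm w)) := by
    filter_upwards [eventually_comp_chart_symm hz hgram,
      eventually_comp_chart_symm hz (hdet.continuousAt.eventually_ne hdet0),
      eventually_comp_chart_symm hz (eventually_linearIndependent hs.holAt hs.li)]
      with w h1 h2 h3
    have h4 : h.logGram t (φ.symm w) = Real.log (h.gramDet fun j => t j (φ.symm w)) := rfl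
    rw [h4, h1, Real.log_mul (by simpa using h2) (h.gramDet_pos h3).ne', normSq_eq_norm_sq,
      Real.log_pow]
    simp [hφ]
    rfl
  have hsm := (h.contDiffAt_log_gramDet hz hs.holAt hs.li).of_le
    (WithTop.coe_le_coe.2 (le_top : (2 : ℕ∞) ≤ ⊤))
  have h2sm : ContDiffAt ℝ 2 ((2 : ℝ) • fun w => Real.log ‖(M (φ.symm w)).det‖) z :=
    contDiffAt_const.smul hharm.1
  rw [Sub.chernDensity]
  congr 1
  have e1 := (InnerProductSpace.laplacian_congr_nhds hlog).self_of_nhds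
  refine e1.trans ?_
  rw [h2sm.laplacian_add hsm, InnerProductSpace.laplacian_smul _ hharm.1,
    hharm.2.self_of_nhds]
  simp
  rfl

theorem continuousAt_laplacian {g : ℂ → ℝ} {z : ℂ} (hg : ContDiffAt ℝ ∞ g z) :
    ContinuousAt (Laplacian.laplacian g) z := by
  have h2 : ContDiffAt ℝ 2 g z := hg.of_le (WithTop.coe_le_coe.2 (le_top : (2 : ℕ∞) ≤ ⊤))
  have hev : Laplacian.laplacian g =ᶠ[𝓝 z] fun w => fderiv ℝ (fun y => fderiv ℝ g y 1) w 1 +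
      fderiv ℝ (fun y => fderiv ℝ g y I) w I := by
    filter_upwards [h2.eventually (by simp)] with w hw
    exact laplacian_eq_fderiv hw
  have hc : ∀ v : ℂ, ContinuousAt (fun w => fderiv ℝ (fun y => fderiv ℝ g y v) w v) z :=
    fun v => (((((h2.fderiv_right (m := 1) (by norm_num)).clm_apply
      contDiffAt_const).fderiv_right (m := 0) (by norm_num)).clm_apply
        contDiffAt_const)).continuousAt
  exact ((hc 1).add (hc I)).congr hev.symm

/-- The frame in the definition is chosen anew at every point, so continuity is not immediate; near
a given point `chernDensity_eq` replaces all these choices by a single frame. -/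
theorem Sub.continuousOn_chernDensity (S : V.Sub) (h : V.HermitianMetric) (c : X) :
    ContinuousOn (S.chernDensity h c) (chartAt ℂ c).target := by
  intro z hz
  have hf := S.isFrameAt_frame ((chartAt ℂ c).symm z)
  have hev : S.chernDensity h c =ᶠ[𝓝 z] fun w => -(1 / (4 * Real.pi)) * Laplacian.laplacian
      (fun w => Real.log (h.gramDet fun i =>
        S.frame ((chartAt ℂ c).symm z) i ((chartAt ℂ c).symm w))) w := by
    filter_upwards [eventually_comp_chart_symm hz hf.eventually,
      (chartAt ℂ c).open_target.mem_nhds hz] with w hw hwT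
    exact S.chernDensity_eq h hwT hw
  have hc := continuousAt_laplacian (h.contDiffAt_log_gramDet hz hf.holAt hf.li)
  exact ((continuousAt_const.mul hc).congr hev.symm).continuousWithinAt

end HolVB

end

/-! ### The norm of the determinant of a twisted map and its curvature. -/

noncomputable section

variable {X : Type u} [TopologicalSpace X] [ChartedSpace ℂ X] [IsManifold 𝓘(ℂ) ω X]
open Filter Topology Complex

variable {r r' : ℕ} {V : HolVB.{u, v₁} X r} {W : HolVB.{u, v₂} X r'} {L : HolVB.{u, v₃} X 1}

theorem laplacian_add_smul_add_sub {a b c d : ℂ → ℝ} {z : ℂ} (ha : ContDiffAt ℝ 2 a z)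
    (hb : ContDiffAt ℝ 2 b z) (hc : ContDiffAt ℝ 2 c z) (hd : ContDiffAt ℝ 2 d z) (t : ℝ) :
    Laplacian.laplacian (a + t • b + c - d) z = Laplacian.laplacian a z +
      t * Laplacian.laplacian b z + Laplacian.laplacian c z - Laplacian.laplacian d z := by
  have htb : ContDiffAt ℝ 2 (t • b) z := contDiffAt_const.smul hb
  have hab : ContDiffAt ℝ 2 (a + t • b) z := ha.add htb
  have habc : ContDiffAt ℝ 2 (a + t • b + c) z := hab.add hc
  rw [habc.laplacian_sub hd, hab.laplacian_add hc, ha.laplacian_add htb,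
    InnerProductSpace.laplacian_smul _ hb, smul_eq_mul]

namespace TwistedMap

/-- A basis of the fibre at `y` adapted to the kernel of a twisted map, and the images of the
complementary basis vectors. -/
structure AdaptedFrame (f : TwistedMap V W L) (y : X) (n m : ℕ) where
  e : Fin n ⊕ Fin m → V.Fiber y
  g : Fin m → W.Fiber y
  l : L.Fiber y
  li : LinearIndependent ℂ e
  span_e : Submodule.span ℂ (range e) = ⊤
  span_inl : Submodule.span ℂ (range fun i => e (Sum.inl i)) = f.kerCarrier y
  l_ne_zero : l ≠ 0
  map_inr : ∀ j, f.toFun y (e (Sum.inr j)) = g j ⊗ₜ[ℂ] l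

variable {f : TwistedMap V W L}

/-- The squared norm of the determinant of the map induced on the quotient by the kernel. -/
def AdaptedFrame.value {y : X} {n m : ℕ} (A : f.AdaptedFrame y n m) (hV : V.HermitianMetric)
    (hW : W.HermitianMetric) (hL : L.HermitianMetric) : ℝ :=
  hW.gramDet A.g * hL.gramDet (fun _ : Fin 1 => A.l) ^ m *
    hV.gramDet (fun i => A.e (Sum.inl i)) / hV.gramDet A.e

/-- Two adapted bases differ by a block triangular matrix with diagonal blocks a' on the kernel and
d on the quotient, and l changes by a scalar c. The factors |det a'|², |det d|² and |c|^(2m) cancel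
in the quotient. Hence the value depends only on the point, which makes `normFun` a global function.
-/
theorem AdaptedFrame.value_eq {y : X} {n m : ℕ} (A A' : f.AdaptedFrame y n m)
    (hV : V.HermitianMetric) (hW : W.HermitianMetric) (hL : L.HermitianMetric) :
    A'.value hV hW hL = A.value hV hW hL := by
  have h1 : ∀ i, ∃ a : Fin n → ℂ, ∑ k, a k • A.e (Sum.inl k) = A'.e (Sum.inl i) := fun i => by
    refine (Submodule.mem_span_range_iff_exists_fun ℂ).1 ?_
    rw [A.span_inl, ← A'.span_inl]
    exact Submodule.subset_span ⟨i, rfl⟩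
  choose a ha using h1
  have h2 : ∀ j, ∃ b : Fin n ⊕ Fin m → ℂ, ∑ k, b k • A.e k = A'.e (Sum.inr j) := fun j => by
    refine (Submodule.mem_span_range_iff_exists_fun ℂ).1 ?_
    rw [A.span_e]; trivial
  choose b hb using h2
  obtain ⟨c, hc⟩ := exists_smul_of_rank_one (L.finrank_fiber y) A.l_ne_zero A'.l
  have hc0 : c ≠ 0 := by rintro rfl; exact A'.l_ne_zero (by rw [hc, zero_smul])
  let a' : Matrix (Fin n) (Fin n) ℂ := Matrix.of fun k i => a i k
  let d : Matrix (Fin m) (Fin m) ℂ := Matrix.of fun k j => b j (Sum.inr k)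
  let P : Matrix (Fin n ⊕ Fin m) (Fin n ⊕ Fin m) ℂ :=
    Matrix.fromBlocks a' (Matrix.of fun k j => b j (Sum.inl k)) 0 d
  have he : hV.gramDet A'.e = normSq (a'.det * d.det) * hV.gramDet A.e := by
    rw [← Matrix.det_fromBlocks_zero₂₁ a' (Matrix.of fun k j => b j (Sum.inl k)) d,
      ← hV.gramDet_sum_smul]
    congr 1
    funext j
    rcases j with j | j
    · rw [← ha j, Fintype.sum_sum_type]; simp [a']
    · rw [← hb j, Fintype.sum_sum_type, Fintype.sum_sum_type]; simp [d]
  have hinl : hV.gramDet (fun i => A'.e (Sum.inl i)) =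
      normSq a'.det * hV.gramDet (fun i => A.e (Sum.inl i)) := by
    rw [← hV.gramDet_sum_smul]
    congr 1
    funext j
    rw [← ha j]
    rfl
  have hl : hL.gramDet (fun _ : Fin 1 => A'.l) =
      normSq c * hL.gramDet (fun _ : Fin 1 => A.l) := by
    have := hL.gramDet_smul (fun _ : Fin 1 => A.l) (fun _ => c)
    rw [Fin.prod_univ_one] at this
    rw [← this, ← hc]
  have hker : ∀ k, f.toFun y (A.e (Sum.inl k)) = 0 := fun k => by
    refine f.kerCarrier_le_ker y ?_
    rw [← A.span_inl]
    exact Submodule.subset_span ⟨k, rfl⟩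
  have hcg : ∀ j, c • A'.g j = ∑ k, d k j • A.g k := fun j => by
    refine tmul_right_injective A.l_ne_zero ?_
    have h3 := A'.map_inr j
    rw [← hb j, Fintype.sum_sum_type, map_add, map_sum, map_sum, hc] at h3
    simp only [map_smul, hker, A.map_inr, smul_zero, Finset.sum_const_zero, zero_add] at h3
    simp only [TensorProduct.sum_tmul, ← TensorProduct.smul_tmul']
    rw [← TensorProduct.tmul_smul, ← h3]
    rfl
  have hg : normSq c ^ m * hW.gramDet A'.g = normSq d.det * hW.gramDet A.g := by
    rw [← hW.gramDet_sum_smul, ← funext hcg, hW.gramDet_smul A'.g fun _ => c]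
    simp
  have hpos := hV.gramDet_pos A'.li
  rw [he, map_mul] at hpos
  have ha0 : normSq a'.det ≠ 0 := fun h => by simp [h] at hpos
  have hd0 : normSq d.det ≠ 0 := fun h => by simp [h] at hpos
  have hE := (hV.gramDet_pos A.li).ne'
  rw [value, value, he, hinl, hl, map_mul, mul_pow]
  rw [div_eq_div_iff (by positivity) hE]
  linear_combination (hL.gramDet (fun _ : Fin 1 => A.l) ^ m * normSq a'.det *
    hV.gramDet (fun i => A.e (Sum.inl i)) * hV.gramDet A.e) * hg

namespace LocalForm

variable [T2Space X] [ConnectedSpace X] {x y : X} (F : f.LocalForm x)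

/-- The frame of the domain in a local form, indexed by the global ranks. -/
def frame (i : Fin f.kerRank ⊕ Fin (r - f.kerRank)) : ∀ y, V.Fiber y :=
  F.e (Sum.map (Fin.cast F.n_eq.symm) (Fin.cast F.m_eq.symm) i)

/-- The images of the complementary frame in a local form, indexed by the global rank. -/
def image (j : Fin (r - f.kerRank)) (y : X) : W.Fiber y :=
  F.factor (Fin.cast F.m_eq.symm j) y • F.g (Sum.inl (Fin.cast F.m_eq.symm j)) y

theorem li_frame (hy : y ∈ F.U) : LinearIndependent ℂ fun i => F.frame i y :=
  (F.li_e y hy).comp _ ((Fin.cast_injective _).sumMap (Fin.cast_injective _))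

theorem li_frame_inl (hy : y ∈ F.U) : LinearIndependent ℂ fun i => F.frame (Sum.inl i) y :=
  (F.li_frame hy).comp _ Sum.inl_injective

theorem holAt_frame (hy : y ∈ F.U) (i) : V.HolAt y (F.frame i) := F.holAt_e _ y hy

theorem card_frame : Fintype.card (Fin f.kerRank ⊕ Fin (r - f.kerRank)) = r := by
  have := f.kerRank_le
  simp; omega

theorem holAt_image (hy : y ∈ F.U) (j) : W.HolAt y (F.image j) := by
  refine HolVB.HolAt.smul ?_ (F.holAt_g _ y hy)
  exact ((contMDiffAt_chart (F.subset_source hy)).sub contMDiffAt_const).pow _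

theorem span_frame_inl (hy : y ∈ F.U) :
    Submodule.span ℂ (range fun i => F.frame (Sum.inl i) y) = f.kerCarrier y := by
  rw [F.kerCarrier_eq hy]
  congr 1
  exact (finCongr F.n_eq.symm).surjective.range_comp fun i => F.e (Sum.inl i) y

/-- The adapted basis at a point near the centre of a local form. -/
def adapted (hy : y ∈ F.U) : f.AdaptedFrame y f.kerRank (r - f.kerRank) where
  e i := F.frame i y
  g j := F.image j y
  l := F.l y
  li := F.li_frame hy
  span_e := HolVB.span_eq_top_of_linearIndependent (F.li_frame hy) card_frame
  span_inl := F.span_frame_inl hy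
  l_ne_zero := F.l_ne_zero y hy
  map_inr _ := (F.map_inr y hy _).trans (TensorProduct.smul_tmul' _ _ _)

theorem li_image (hy : y ∈ F.U) (h : ∀ j, F.factor j y ≠ 0) :
    LinearIndependent ℂ fun j => F.image j y := by
  rw [Fintype.linearIndependent_iff]
  intro c hc j
  simp only [image, smul_smul] at hc
  have hli := (F.li_g_inl hy).comp _ (Fin.cast_injective F.m_eq.symm)
  exact (mul_eq_zero.1 (Fintype.linearIndependent_iff.1 hli _ hc j)).resolve_right (h _)

end LocalForm

variable [T2Space X] [ConnectedSpace X] (f) (hV : V.HermitianMetric)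
    (hW : W.HermitianMetric) (hL : L.HermitianMetric)

/-- The squared norm of the determinant of the map which `f` induces from the quotient of `V` by
the kernel to the saturation of the image. -/
def normFun (y : X) : ℝ := ((f.localForm y).adapted (f.localForm y).mem).value hV hW hL

variable {f}

theorem LocalForm.normFun_eq {x y : X} (F : f.LocalForm x) (hy : y ∈ F.U) :
    f.normFun hV hW hL y = hW.gramDet (fun j => F.image j y) *
      hL.gramDet (fun _ : Fin 1 => F.l y) ^ (r - f.kerRank) *
      hV.gramDet (fun i => F.frame (Sum.inl i) y) / hV.gramDet fun i => F.frame i y :=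
  AdaptedFrame.value_eq (F.adapted hy) _ hV hW hL

theorem LocalForm.gramDet_l_pos {x y : X} (F : f.LocalForm x) (hy : y ∈ F.U) :
    0 < hL.gramDet fun _ : Fin 1 => F.l y :=
  hL.gramDet_pos (LinearIndependent.of_subsingleton 0 (F.l_ne_zero y hy))

variable (f)

theorem normFun_nonneg (y : X) : 0 ≤ f.normFun hV hW hL y := by
  rw [(f.localForm y).normFun_eq hV hW hL (f.localForm y).mem]
  have h1 := hW.gramDet_nonneg fun j => (f.localForm y).image j y
  have h2 := (f.localForm y).gramDet_l_pos hL (f.localForm y).mem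
  have h3 := hV.gramDet_pos ((f.localForm y).li_frame_inl (f.localForm y).mem)
  have h4 := hV.gramDet_pos ((f.localForm y).li_frame (f.localForm y).mem)
  positivity

/-- Smoothness includes the zeros: the image vectors remain holomorphic where the monomials vanish,
and the denominator is the Gram determinant of a genuine frame. -/
theorem contMDiff_normFun : ContMDiff 𝓘(ℝ, ℂ) 𝓘(ℝ, ℝ) ∞ (f.normFun hV hW hL) := by
  intro x
  let F := f.localForm x
  have h1 := hW.contMDiffAt_gramDet fun j => F.holAt_image F.mem j
  have h2 := hL.contMDiffAt_gramDet (ι := Fin 1) (s := fun _ => F.l) fun _ => F.holAt_l x F.mem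
  have h3 := hV.contMDiffAt_gramDet fun i => F.holAt_frame F.mem (Sum.inl i)
  have h4 := hV.contMDiffAt_gramDet fun i => F.holAt_frame F.mem i
  refine (((h1.mul (h2.pow (r - f.kerRank))).mul h3).div₀ h4
    (hV.gramDet_pos (F.li_frame F.mem)).ne').congr_of_eventuallyEq ?_
  filter_upwards [F.isOpen.mem_nhds F.mem] with y hy
  exact F.normFun_eq hV hW hL hy

variable {f} in
theorem LocalForm.normFun_pos {x y : X} (F : f.LocalForm x) (hy : y ∈ F.U) (hne : y ≠ x) :
    0 < f.normFun hV hW hL y := by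
  rw [F.normFun_eq hV hW hL hy]
  have h1 := hW.gramDet_pos (F.li_image hy (F.factor_ne_zero hy hne))
  have h2 := F.gramDet_l_pos hL hy
  have h3 := hV.gramDet_pos (F.li_frame_inl hy)
  have h4 := hV.gramDet_pos (F.li_frame hy)
  positivity

/-- Within the domain of a local form only the centre can be a zero, and finitely many such domains
cover X. -/
theorem finite_normFun_eq_zero [CompactSpace X] : {x | f.normFun hV hW hL x = 0}.Finite := by
  obtain ⟨t, ht⟩ := isCompact_univ.elim_finite_subcover (fun x => (f.localForm x).U)
    (fun x => (f.localForm x).isOpen) fun x _ => mem_iUnion.2 ⟨x, (f.localForm x).mem⟩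
  refine t.finite_toSet.subset fun y hy => ?_
  obtain ⟨x, hx, hyx⟩ := mem_iUnion₂.1 (ht (mem_univ y))
  by_cases h : y = x
  · rwa [h]
  · exact absurd hy ((f.localForm x).normFun_pos hV hW hL hyx h).ne'

/-- The images lie in the saturated image, and where no monomial vanishes they are independent and
of the right number. -/
theorem isFrameAt_image {x : X} (F : f.LocalForm x) (h : ∀ j, F.factor j x ≠ 0) :
    f.imSub.IsFrameAt x F.image := by
  have hli := F.li_image F.mem h
  refine ⟨by simp [imSub], F.holAt_image F.mem, hli, ?_⟩
  filter_upwards [F.isOpen.mem_nhds F.mem,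
    HolVB.eventually_linearIndependent (F.holAt_image F.mem) hli] with y hy hyl
  change _ = f.imCarrier y
  refine Submodule.eq_of_le_of_finrank_eq ?_ ?_
  · rw [Submodule.span_le, F.imCarrier_eq hy]
    rintro _ ⟨j, rfl⟩
    exact Submodule.smul_mem _ _ (Submodule.subset_span ⟨_, rfl⟩)
  · rw [finrank_span_eq_card hyl, F.imCarrier_eq hy, finrank_span_eq_card (F.li_g_inl hy)]
    simp [F.m_eq]

/-- The curvature of the determinant of `f`. -/
theorem laplacian_log_normFun {c : X} {z : ℂ} (hz : z ∈ (chartAt ℂ c).target)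
    (hpos : 0 < f.normFun hV hW hL ((chartAt ℂ c).symm z)) :
    Laplacian.laplacian (fun w => Real.log (f.normFun hV hW hL ((chartAt ℂ c).symm w))) z =
      -(4 * Real.pi) * (f.imSub.chernDensity hW c z +
        (r - f.kerRank : ℕ) * L.top.chernDensity hL c z +
        f.kerSub.chernDensity hV c z - V.top.chernDensity hV c z) := by
  set m := r - f.kerRank with hm
  let F := f.localForm ((chartAt ℂ c).symm z)
  have hU := F.mem
  -- The norm contains the squared modulus of the product of the monomial factors, so its positivity
  -- forces each of them to be nonzero and the image vectors to form a frame.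
  have hfac : ∀ j, F.factor j ((chartAt ℂ c).symm z) ≠ 0 := by
    have hg : hW.gramDet (fun j => F.image j ((chartAt ℂ c).symm z)) ≠ 0 := by
      intro h0
      rw [F.normFun_eq hV hW hL hU, h0] at hpos
      simp at hpos
    simp only [LocalForm.image] at hg
    rw [hW.gramDet_smul (fun j => F.g (Sum.inl (Fin.cast F.m_eq.symm j)) _)] at hg
    have hp := (map_ne_zero normSq).1 (left_ne_zero_of_mul hg)
    intro j
    exact Finset.prod_ne_zero_iff.1 hp (Fin.cast F.m_eq j) (Finset.mem_univ _)
  have fr1 := f.isFrameAt_image F hfac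
  have fr2 : L.top.IsFrameAt ((chartAt ℂ c).symm z) (fun _ : Fin 1 => F.l) :=
    HolVB.isFrameAt_top (by simp) (fun _ => F.holAt_l _ hU)
      (LinearIndependent.of_subsingleton 0 (F.l_ne_zero _ hU))
  have fr3 : f.kerSub.IsFrameAt ((chartAt ℂ c).symm z) (fun i => F.frame (Sum.inl i)) := by
    refine ⟨by simp [kerSub], fun i => F.holAt_frame hU _, F.li_frame_inl hU, ?_⟩
    filter_upwards [F.isOpen.mem_nhds hU] with y hy
    exact F.span_frame_inl hy
  have fr4 : V.top.IsFrameAt ((chartAt ℂ c).symm z) F.frame :=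
    HolVB.isFrameAt_top LocalForm.card_frame (F.holAt_frame hU) (F.li_frame hU)
  rw [HolVB.Sub.chernDensity_eq hW hz fr1, HolVB.Sub.chernDensity_eq hL hz fr2,
    HolVB.Sub.chernDensity_eq hV hz fr3, HolVB.Sub.chernDensity_eq hV hz fr4]
  have h2 : (2 : ℕ∞ω) ≤ ∞ := WithTop.coe_le_coe.2 (le_top : (2 : ℕ∞) ≤ ⊤)
  have s1 := (hW.contDiffAt_log_gramDet hz fr1.holAt fr1.li).of_le h2
  have s2 := (hL.contDiffAt_log_gramDet hz fr2.holAt fr2.li).of_le h2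
  have s3 := (hV.contDiffAt_log_gramDet hz fr3.holAt fr3.li).of_le h2
  have s4 := (hV.contDiffAt_log_gramDet hz fr4.holAt fr4.li).of_le h2
  have hev : (fun w => Real.log (f.normFun hV hW hL ((chartAt ℂ c).symm w))) =ᶠ[𝓝 z]
      (((fun w => Real.log (hW.gramDet fun j => F.image j ((chartAt ℂ c).symm w))) +
        (m : ℝ) • (fun w => Real.log (hL.gramDet fun _ : Fin 1 => F.l ((chartAt ℂ c).symm w)))) +
        (fun w => Real.log (hV.gramDet fun i => F.frame (Sum.inl i) ((chartAt ℂ c).symm w)))) -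
        (fun w => Real.log (hV.gramDet fun i => F.frame i ((chartAt ℂ c).symm w))) := by
    filter_upwards [eventually_comp_chart_symm hz (F.isOpen.mem_nhds hU),
      eventually_comp_chart_symm hz fr1.eventually] with w hw hw1
    have p1 := hW.gramDet_pos hw1.li
    have p2 := F.gramDet_l_pos hL hw
    have p3 := hV.gramDet_pos (F.li_frame_inl hw)
    have p4 := hV.gramDet_pos (F.li_frame hw)
    rw [F.normFun_eq hV hW hL hw, Real.log_div (by positivity) p4.ne',
      Real.log_mul (by positivity) p3.ne', Real.log_mul p1.ne' (by positivity), Real.log_pow]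
    rfl
  rw [(InnerProductSpace.laplacian_congr_nhds hev).self_of_nhds,
    laplacian_add_smul_add_sub s1 s2 s3 s4]
  have := Real.pi_ne_zero
  field_simp
  ring

end TwistedMap

end

/-! ### Integration of the curvature and the degree inequality. -/

noncomputable section

variable {X : Type u} [TopologicalSpace X] [ChartedSpace ℂ X] [IsManifold 𝓘(ℂ) ω X]
open Filter Topology Complex

section Integral

variable [T2Space X] [CompactSpace X]

theorem integrableOn_chartPartition_mul {c : X} {η : ℂ → ℝ}
    (hη : ContinuousOn η (chartAt ℂ c).target) :
    IntegrableOn (fun z => chartPartition X c ((chartAt ℂ c).symm z) * η z)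
      (chartAt ℂ c).target := by
  have hsub := chartPartition_isSubordinate X c
  have hO := (chartAt ℂ c).open_target
  obtain ⟨hc, ht⟩ := tsupport_chartPush c hsub
  refine ((integrable_mul_of_tsupport hO
    (contDiff_chartPush (contMDiff_chartPartition c) hsub).continuous hc ht hη).integrableOn
    (s := (chartAt ℂ c).target)).congr_fun (fun z hz => ?_) hO.measurableSet
  exact congrArg (· * η z) (chartPush_eventuallyEq c _ hz).eq_of_nhds

theorem integralTwoForm_add {η η' : X → ℂ → ℝ}
    (h : ∀ c, ContinuousOn (η c) (chartAt ℂ c).target)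
    (h' : ∀ c, ContinuousOn (η' c) (chartAt ℂ c).target) :
    integralTwoForm (fun c z => η c z + η' c z) = integralTwoForm η + integralTwoForm η' := by
  simp only [integralTwoForm_eq_sum, ← Finset.sum_add_distrib]
  refine Finset.sum_congr rfl fun c _ => ?_
  rw [← integral_add (integrableOn_chartPartition_mul (h c)) (integrableOn_chartPartition_mul (h' c))]
  simp only [mul_add]

theorem integralTwoForm_const_mul (t : ℝ) (η : X → ℂ → ℝ) :
    integralTwoForm (fun c z => t * η c z) = t * integralTwoForm η := by
  simp only [integralTwoForm_eq_sum, Finset.mul_sum]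
  refine Finset.sum_congr rfl fun c _ => ?_
  rw [← integral_const_mul]
  simp only [mul_left_comm t]

theorem ae_chart_of_finite {p : X → Prop} (hp : {x | ¬ p x}.Finite) (c : X) :
    ∀ᵐ z ∂(volume.restrict (chartAt ℂ c).target), p ((chartAt ℂ c).symm z) := by
  rw [ae_restrict_iff' (chartAt ℂ c).open_target.measurableSet]
  have hfin : (chartAt ℂ c '' {x | ¬ p x}).Finite := hp.image _
  filter_upwards [hfin.measure_zero volume |> measure_eq_zero_iff_ae_notMem.1] with z hz hzT
  by_contra h
  exact hz ⟨_, h, (chartAt ℂ c).right_inv hzT⟩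

/-- A smooth nonnegative function with finitely many zeros has nonpositive total
logarithmic Laplacian. -/
theorem integralTwoForm_laplacian_log_nonpos {N : X → ℝ} (hN : ContMDiff 𝓘(ℝ, ℂ) 𝓘(ℝ, ℝ) ∞ N)
    (h0 : ∀ x, 0 ≤ N x) (hfin : {x | N x = 0}.Finite) {η : X → ℂ → ℝ}
    (hη : ∀ c, ContinuousOn (η c) (chartAt ℂ c).target)
    (hlog : ∀ c, ∀ z ∈ (chartAt ℂ c).target, 0 < N ((chartAt ℂ c).symm z) →
      Laplacian.laplacian (fun w => Real.log (N ((chartAt ℂ c).symm w))) z = η c z) :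
    integralTwoForm η ≤ 0 := by
  have hNc : ∀ c, ContinuousOn (fun z => N ((chartAt ℂ c).symm z)) (chartAt ℂ c).target :=
    fun c z hz => (contDiffAt_chart_of_contMDiff hN hz).continuousAt.continuousWithinAt
  have hpos : ∀ c, ∀ᵐ z ∂(volume.restrict (chartAt ℂ c).target),
      0 < N ((chartAt ℂ c).symm z) := fun c =>
    ae_chart_of_finite (hfin.subset fun x hx => le_antisymm (not_lt.1 hx) (h0 x)) c
  let ε : ℕ → ℝ := fun k => 1 / ((k : ℝ) + 1)
  have hε : ∀ k, 0 < ε k := fun k => by positivity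
  -- The weight N/(N + ε) of `laplacian_log_add_ge`: between 0 and 1, tending to 1 off the finitely
  -- many zeros of N.
  let q : ℕ → X → ℂ → ℝ := fun k c z =>
    N ((chartAt ℂ c).symm z) / (N ((chartAt ℂ c).symm z) + ε k)
  have hne : ∀ k x, N x + ε k ≠ 0 := fun k x => (add_pos_of_nonneg_of_pos (h0 x) (hε k)).ne'
  have hqc : ∀ k c, ContinuousOn (fun z => q k c z * η c z) (chartAt ℂ c).target := fun k c =>
    ((hNc c).div ((hNc c).add continuousOn_const) fun z _ => hne k _).mul (hη c)
  have hq0 : ∀ k c z, 0 ≤ q k c z := fun k c z =>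
    div_nonneg (h0 _) (add_nonneg (h0 _) (hε k).le)
  have hq1 : ∀ k c z, q k c z ≤ 1 := fun k c z =>
    div_le_one_of_le₀ (by linarith [hε k]) (add_nonneg (h0 _) (hε k).le)
  -- The function log(N + ε) is smooth on all of X, so its Laplacian has integral 0; it dominates
  -- the weighted density almost everywhere.
  have step : ∀ k, integralTwoForm (fun c z => q k c z * η c z) ≤ 0 := by
    intro k
    have hsm : ContMDiff 𝓘(ℝ, ℂ) 𝓘(ℝ, ℝ) ∞ (fun x => Real.log (N x + ε k)) := fun x =>
      ((Real.contDiffAt_log.2 (hne k x)).contMDiffAt).comp x ((hN x).add contMDiffAt_const)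
    rw [← integralTwoForm_laplacian hsm]
    simp only [integralTwoForm_eq_sum]
    refine Finset.sum_le_sum fun c _ => ?_
    have hLc : ContinuousOn (Laplacian.laplacian fun w =>
        Real.log (N ((chartAt ℂ c).symm w) + ε k)) (chartAt ℂ c).target := fun z hz =>
      (HolVB.continuousAt_laplacian
        (contDiffAt_chart_of_contMDiff hsm hz)).continuousWithinAt
    refine integral_mono_ae (integrableOn_chartPartition_mul (hqc k c))
      (integrableOn_chartPartition_mul hLc) ?_
    filter_upwards [hpos c, ae_restrict_mem (chartAt ℂ c).open_target.measurableSet] with z hz hzT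
    refine mul_le_mul_of_nonneg_left ?_ ((chartPartition X).nonneg c _)
    rw [← hlog c z hzT hz]
    exact laplacian_log_add_ge (Φ := fun w => N ((chartAt ℂ c).symm w))
      ((contDiffAt_chart_of_contMDiff hN hzT).of_le
        (WithTop.coe_le_coe.2 (le_top : (2 : ℕ∞) ≤ ⊤))) hz (hε k).le
  -- Dominated convergence applies because η, unlike the Laplacian of log N, is continuous across
  -- the zeros.
  suffices hlim : Tendsto (fun k => integralTwoForm fun c z => q k c z * η c z) atTop
      (𝓝 (integralTwoForm η)) from le_of_tendsto' hlim step
  simp only [integralTwoForm_eq_sum]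
  refine tendsto_finsetSum _ fun c _ => ?_
  refine tendsto_integral_of_dominated_convergence
    (fun z => ‖chartPartition X c ((chartAt ℂ c).symm z) * η c z‖)
    (fun k => (integrableOn_chartPartition_mul (hqc k c)).aestronglyMeasurable)
    (integrableOn_chartPartition_mul (hη c)).norm (fun k => Eventually.of_forall fun z => ?_) ?_
  · rw [mul_left_comm, norm_mul, Real.norm_of_nonneg (hq0 k c z)]
    exact mul_le_of_le_one_left (norm_nonneg _) (hq1 k c z)
  · filter_upwards [hpos c] with z hz
    have hεt : Tendsto ε atTop (𝓝 0) := tendsto_one_div_add_atTop_nhds_zero_nat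
    have h1 : Tendsto (fun k => q k c z) atTop (𝓝 1) := by
      have := (tendsto_const_nhds (x := N ((chartAt ℂ c).symm z))).div
        ((tendsto_const_nhds (x := N ((chartAt ℂ c).symm z))).add hεt) (by simpa using hz.ne')
      rwa [add_zero, div_self hz.ne'] at this
    simpa using (h1.mul_const (η c z)).const_mul (chartPartition X c ((chartAt ℂ c).symm z))

end Integral

variable {r r' : ℕ} {V : HolVB.{u, v₁} X r} {W : HolVB.{u, v₂} X r'} {L : HolVB.{u, v₃} X 1}

/-- The degree of a bundle is bounded by those of the kernel and of the saturated image of a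
twisted map. -/
theorem TwistedMap.degree_le [T2Space X] [CompactSpace X] [ConnectedSpace X]
    (f : TwistedMap V W L) :
    V.degree ≤ f.kerSub.degree + f.imSub.degree + (r - f.kerRank : ℕ) * L.degree := by
  set m := r - f.kerRank with hm
  have c1 := f.imSub.continuousOn_chernDensity W.metric
  have c2 := L.top.continuousOn_chernDensity L.metric
  have c3 := f.kerSub.continuousOn_chernDensity V.metric
  have c4 := V.top.continuousOn_chernDensity V.metric
  have h := integralTwoForm_laplacian_log_nonpos
    (f.contMDiff_normFun V.metric W.metric L.metric)
    (f.normFun_nonneg V.metric W.metric L.metric)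
    (f.finite_normFun_eq_zero V.metric W.metric L.metric)
    (η := fun c z => -(4 * Real.pi) * (f.imSub.chernDensity W.metric c z +
        m * L.top.chernDensity L.metric c z +
        f.kerSub.chernDensity V.metric c z + (-1) * V.top.chernDensity V.metric c z))
    (fun c => continuousOn_const.mul ((((c1 c).add (continuousOn_const.mul (c2 c))).add (c3 c)).add
      (continuousOn_const.mul (c4 c))))
    (fun c z hz hpos => by
      rw [f.laplacian_log_normFun _ _ _ hz hpos]; ring)
  have a1 := integralTwoForm_add c1 (η' := fun c z => m * L.top.chernDensity L.metric c z)
    (fun c => continuousOn_const.mul (c2 c))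
  have a2 := integralTwoForm_add (η := fun c z => f.imSub.chernDensity W.metric c z +
    m * L.top.chernDensity L.metric c z) (fun c => (c1 c).add (continuousOn_const.mul (c2 c))) c3
  have a3 := integralTwoForm_add (η := fun c z => f.imSub.chernDensity W.metric c z +
    m * L.top.chernDensity L.metric c z + f.kerSub.chernDensity V.metric c z)
    (η' := fun c z => (-1) * V.top.chernDensity V.metric c z)
    (fun c => ((c1 c).add (continuousOn_const.mul (c2 c))).add (c3 c))
    (fun c => continuousOn_const.mul (c4 c))
  rw [integralTwoForm_const_mul, a3, a2, a1, integralTwoForm_const_mul,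
    integralTwoForm_const_mul] at h
  have h2 := nonneg_of_mul_nonpos_right h (by have := Real.pi_pos; linarith)
  simp only [HolVB.degree, HolVB.Sub.degree]
  linarith

/-- The Gram determinant of the empty family is 1, so its logarithm and the Chern density vanish. -/
theorem HolVB.Sub.degree_eq_zero [T2Space X] [CompactSpace X] (S : V.Sub) (hS : S.rank = 0) :
    S.degree = 0 := by
  have : IsEmpty (Fin S.rank) := by rw [hS]; infer_instance
  have h1 : ∀ s : Fin S.rank → ∀ y, V.Fiber y, V.metric.logGram s = fun _ => 0 := by
    intro s
    funext y
    simp [HermitianMetric.logGram]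
  have h : ∀ c z, S.chernDensity V.metric c z = 0 * S.chernDensity V.metric c z := by
    intro c z
    simp [Sub.chernDensity, h1]
  rw [Sub.degree, funext fun c => funext (h c), integralTwoForm_const_mul, zero_mul]

/-- All fibres of S are full, so frames of V are frames of S and the densities agree. This is needed
when the saturated image is all of the target bundle without being `top` by definition. -/
theorem HolVB.Sub.degree_eq_of_rank_eq [T2Space X] [CompactSpace X] (S : V.Sub) (hS : S.rank = r) :
    S.degree = V.degree := by
  have htop : ∀ y, S.carrier y = ⊤ := by
    intro y
    have h := S.isFrameAt_frame y
    rw [← h.span.self_of_nhds]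
    exact span_eq_top_of_linearIndependent h.li (by simpa using hS)
  rw [HolVB.degree, Sub.degree, Sub.degree, integralTwoForm_eq_sum, integralTwoForm_eq_sum]
  refine Finset.sum_congr rfl fun c _ => ?_
  refine setIntegral_congr_fun (chartAt ℂ c).open_target.measurableSet fun z hz => ?_
  have h := V.top.isFrameAt_frame ((chartAt ℂ c).symm z)
  have h' : S.IsFrameAt ((chartAt ℂ c).symm z) (V.top.frame ((chartAt ℂ c).symm z)) :=
    ⟨h.card.trans hS.symm, h.holAt, h.li, h.span.mono fun y hy => by rw [hy, htop]; rfl⟩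
  exact congrArg (_ * ·) ((S.chernDensity_eq V.metric hz h').trans
    (V.top.chernDensity_eq V.metric hz h).symm)

end

/-! ### Numerical consequences of semistability. -/

noncomputable section

variable {X : Type u} [TopologicalSpace X] [ChartedSpace ℂ X] [IsManifold 𝓘(ℂ) ω X]

namespace TwistedHiggs

variable {p q : ℕ} {L : HolVB.{u, v₃} X 1} [T2Space X] [CompactSpace X]

/-- The twisted Higgs bundle with the roles of the two bundles exchanged. -/
def swap (E : TwistedHiggs.{u, v₁, v₂, v₃} p q L) : TwistedHiggs.{u, v₂, v₁, v₃} q p L :=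
  ⟨E.W, E.V, E.γ, E.β⟩

/-- The proportions p'/(p' + q') and q'/(p' + q') add up to 1, so exchanging the bundles and
negating α shifts every slope by the same constant, which preserves semistability. -/
theorem subSlope_swap (E : TwistedHiggs.{u, v₁, v₂, v₃} p q L) (α : ℝ) (V' : E.V.Sub)
    (W' : E.W.Sub) (h : ¬ (V'.rank = 0 ∧ W'.rank = 0)) :
    E.swap.subSlope (-α) W' V' = E.subSlope α V' W' - α := by
  have hne : (V'.rank : ℝ) + W'.rank ≠ 0 := by
    have : V'.rank + W'.rank ≠ 0 := by omega
    exact_mod_cast this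
  change (W'.degree + V'.degree) / ((W'.rank : ℝ) + V'.rank) +
      -α * ((W'.rank : ℝ) / (W'.rank + V'.rank)) =
    (V'.degree + W'.degree) / ((V'.rank : ℝ) + W'.rank) +
      α * ((V'.rank : ℝ) / (V'.rank + W'.rank)) - α
  rw [add_comm (W'.rank : ℝ), add_comm W'.degree]
  field_simp
  ring

theorem IsSemistable.swap {E : TwistedHiggs.{u, v₁, v₂, v₃} p q L} {α : ℝ} (hp : 0 < p)
    (hE : E.IsSemistable α) : E.swap.IsSemistable (-α) := by
  intro W' V' hsub h0 h1
  have h := hE V' W' ⟨hsub.2, hsub.1⟩ (fun h => h0 h.symm) (fun h => h1 h.symm)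
  have e1 := E.subSlope_swap α V' W' (fun h => h0 h.symm)
  have e2 := E.subSlope_swap α E.V.top E.W.top (fun h => hp.ne' h.1)
  change E.swap.subSlope (-α) W' V' ≤ E.swap.subSlope (-α) E.W.top E.V.top
  rw [e1, e2]
  exact sub_le_sub_right h α

theorem threshold_swap (E : TwistedHiggs.{u, v₁, v₂, v₃} p q L) (j : ℤ) :
    E.swap.threshold j = -E.threshold' j := by
  simp only [threshold, threshold', swap]
  rw [show (2 : ℝ) * q * p = 2 * p * q by ring, add_comm (q : ℝ) p]
  ring

variable [ConnectedSpace X]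

/-- The numerical consequence of semistability for the kernel and the saturated image. -/
theorem IsSemistable.kerRank_inequality {E : TwistedHiggs.{u, v₁, v₂, v₃} p q L} {α : ℝ}
    (hp : 0 < p) (hq : 0 < q) (hE : E.IsSemistable α) :
    2 * p * q * (E.W.slope - E.V.slope - L.degree) ≤
      (α - L.degree) * (q * (p - q) + E.β.kerRank * (p + q)) := by
  set n := E.β.kerRank with hn
  have hnq : n ≤ q := E.β.kerRank_le
  have hdeg := E.β.degree_le
  rw [← hn, Nat.cast_sub hnq] at hdeg
  have hp' : (0 : ℝ) < p := by exact_mod_cast hp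
  have hq' : (0 : ℝ) < q := by exact_mod_cast hq
  have hnq' : (n : ℝ) ≤ q := by exact_mod_cast hnq
  set μ := E.slope α with hμ
  have hμ' : μ * (p + q) = E.V.degree + E.W.degree + α * p := by
    rw [hμ, slope, subSlope]
    change ((E.V.degree + E.W.degree) / ((p : ℝ) + q) + α * (p / (p + q))) * (p + q) = _
    field_simp
  -- The subobject (0, ker β). For n = 0 it is the zero subobject, to which semistability does not
  -- apply, but then both sides are 0.
  have hker : E.β.kerSub.degree ≤ n * μ := by
    by_cases h0 : n = 0
    · rw [HolVB.Sub.degree_eq_zero _ (show E.β.kerSub.rank = 0 from h0), h0]; simp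
    · have h := hE E.V.bot E.β.kerSub ⟨E.β.mapsTo_kerSub _, E.γ.bot_mapsTo _⟩
        (fun h => h0 h.2) (fun h => hp.ne h.1)
      rw [subSlope, HolVB.Sub.degree_eq_zero E.V.bot rfl] at h
      change (0 + E.β.kerSub.degree) / (((0 : ℕ) : ℝ) + n) + α * (((0 : ℕ) : ℝ) / _) ≤ μ at h
      have hn0 : (0 : ℝ) < n := by exact_mod_cast Nat.pos_of_ne_zero h0
      simp only [Nat.cast_zero, zero_add, zero_div, mul_zero, add_zero] at h
      rw [div_le_iff₀ hn0] at h
      linarith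
  -- The subobject (I, W) with I the saturated image. If q - n = p it has full rank and is excluded
  -- from semistability, but then equality holds.
  have him : E.β.imSub.degree + E.W.degree + α * (q - n) ≤ (2 * q - n) * μ := by
    by_cases h0 : q - n = p
    · rw [HolVB.Sub.degree_eq_of_rank_eq _ (show E.β.imSub.rank = p from h0)]
      have h1 : (q : ℝ) - n = p := by rw [← Nat.cast_sub hnq, h0]
      rw [show (2 : ℝ) * q - n = p + q by linarith, mul_comm (p + q : ℝ), hμ', h1]
    · have h := hE E.β.imSub E.W.top ⟨E.β.mapsTo_imSub _, E.γ.mapsTo_top _⟩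
        (fun h => hq.ne' h.2) (fun h => h0 h.1)
      rw [subSlope] at h
      change (E.β.imSub.degree + E.W.degree) / (((q - n : ℕ) : ℝ) + q) +
        α * (((q - n : ℕ) : ℝ) / (((q - n : ℕ) : ℝ) + q)) ≤ μ at h
      rw [Nat.cast_sub hnq, mul_div_assoc', ← add_div, div_le_iff₀ (by linarith)] at h
      linarith
  have hV : E.V.degree = p * E.V.slope := by rw [HolVB.slope]; field_simp
  have hW : E.W.degree = q * E.W.slope := by rw [HolVB.slope]; field_simp
  rw [hV, hW] at hμ'
  rw [hW] at hdeg him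
  -- Adding the two slope bounds to the degree inequality eliminates the unknown degrees of the
  -- kernel and of the image.
  have key : 2 * q * E.W.slope - (q - n) * L.degree + α * (q - n) ≤ 2 * q * μ := by linarith
  have key2 := mul_le_mul_of_nonneg_right key (add_pos hp' hq').le
  have e : 2 * q * μ * (p + q) = 2 * q * (p * E.V.slope + q * E.W.slope + α * p) := by
    rw [mul_assoc, hμ']
  rw [e] at key2
  -- The rearrangement uses 2pq - (q - n)(p + q) = q(p - q) + n(p + q).
  nlinarith [key2]

theorem lt_threshold_iff (E : TwistedHiggs.{u, v₁, v₂, v₃} p q L) {α : ℝ} {k : ℤ}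
    (hD : (0 : ℝ) < q * (p - q) + (k + 1) * (p + q)) :
    α < E.threshold k ↔ (α - L.degree) * (q * (p - q) + (k + 1) * (p + q)) <
      2 * p * q * (E.W.slope - E.V.slope - L.degree) := by
  rw [threshold, ← sub_lt_iff_lt_add, div_mul_eq_mul_div, lt_div_iff₀ hD]

/-- Here the left side of `kerRank_inequality` is negative, so α below the threshold forces α < deg
L. The right side then decreases with the rank of the kernel, and a rank of at least i would make it
too small. -/
theorem IsSemistable.kerRank_lt {E : TwistedHiggs.{u, v₁, v₂, v₃} p q L} {α : ℝ}
    (hp : 0 < p) (hq : 0 < q) (hE : E.IsSemistable α) (hpq : q ≤ p)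
    (hδ : E.V.slope - E.W.slope > -L.degree) {i : ℕ} (hi : 1 ≤ i)
    (hα : α < E.threshold (i - 1)) : E.β.kerRank < i := by
  have hineq := hE.kerRank_inequality hp hq
  by_contra! hn
  have hp' : (0 : ℝ) < p := by exact_mod_cast hp
  have hq' : (0 : ℝ) < q := by exact_mod_cast hq
  have hpq' : (q : ℝ) ≤ p := by exact_mod_cast hpq
  have hi' : (1 : ℝ) ≤ i := by exact_mod_cast hi
  have hn' : (i : ℝ) ≤ E.β.kerRank := by exact_mod_cast hn
  have h1 : (0 : ℝ) ≤ q * (p - q) := mul_nonneg hq'.le (by linarith)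
  have h2 : (0 : ℝ) < i * (p + q) := by positivity
  have h3 : (i : ℝ) * (p + q) ≤ E.β.kerRank * (p + q) :=
    mul_le_mul_of_nonneg_right hn' (by positivity)
  have hcast : (((i : ℤ) - 1 : ℤ) : ℝ) + 1 = i := by push_cast; ring
  rw [E.lt_threshold_iff (by rw [hcast]; linarith), hcast] at hα
  have h4 : 2 * p * q * (E.W.slope - E.V.slope - L.degree) < 0 :=
    mul_neg_of_pos_of_neg (by positivity) (by linarith)
  have h5 : α - L.degree < 0 := by
    by_contra! h
    have := mul_nonneg h (show (0 : ℝ) ≤ q * (p - q) + i * (p + q) by linarith)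
    linarith
  have h6 := mul_le_mul_of_nonpos_left
    (show (q * (p - q) + i * (p + q) : ℝ) ≤ q * (p - q) + E.β.kerRank * (p + q) by linarith) h5.le
  linarith

/-- Now the left side of `kerRank_inequality` is positive, which forces α ≥ deg L, and the right
side increases with the rank. The index is an integer with positive denominator, rather than a
natural number, so that k = q - 2 = -1 is covered when q = 1. -/
theorem IsSemistable.lt_kerRank {E : TwistedHiggs.{u, v₁, v₂, v₃} p q L} {α : ℝ}
    (hp : 0 < p) (hq : 0 < q) (hE : E.IsSemistable α) (hpq : q ≤ p)
    (hδ : E.V.slope - E.W.slope < -L.degree) {k : ℤ}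
    (hD : (0 : ℝ) < q * (p - q) + (k + 1) * (p + q))
    (hα : α < E.threshold k) : k + 1 < E.β.kerRank := by
  have hineq := hE.kerRank_inequality hp hq
  by_contra! hn
  have hp' : (0 : ℝ) < p := by exact_mod_cast hp
  have hq' : (0 : ℝ) < q := by exact_mod_cast hq
  have hpq' : (q : ℝ) ≤ p := by exact_mod_cast hpq
  have hn' : (E.β.kerRank : ℝ) ≤ k + 1 := by exact_mod_cast hn
  have h1 : (0 : ℝ) ≤ q * (p - q) := mul_nonneg hq'.le (by linarith)
  have h3 : (E.β.kerRank : ℝ) * (p + q) ≤ (k + 1) * (p + q) :=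
    mul_le_mul_of_nonneg_right hn' (by positivity)
  have h3' : (0 : ℝ) ≤ q * (p - q) + E.β.kerRank * (p + q) := by positivity
  rw [E.lt_threshold_iff hD] at hα
  have h4 : 0 < 2 * p * q * (E.W.slope - E.V.slope - L.degree) :=
    mul_pos (by positivity) (by linarith)
  have h5 : 0 ≤ α - L.degree := by
    by_contra! h
    have := mul_nonpos_of_nonpos_of_nonneg h.le h3'
    linarith
  have h6 := mul_le_mul_of_nonneg_left
    (show (q * (p - q) + E.β.kerRank * (p + q) : ℝ) ≤ q * (p - q) + (k + 1) * (p + q) by linarith) h5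
  linarith

theorem threshold_zero (E : TwistedHiggs.{u, v₁, v₂, v₃} p q L) :
    E.threshold 0 = 2 * p * q / (p * q - q ^ 2 + p + q) *
      (E.W.slope - E.V.slope - L.degree) + L.degree := by
  rw [threshold]
  congr 3
  push_cast
  ring

theorem threshold_sub_two (E : TwistedHiggs.{u, v₁, v₂, v₃} p q L) :
    E.threshold (q - 2) = 2 * p * q / (2 * p * q - p - q) *
      (E.W.slope - E.V.slope - L.degree) + L.degree := by
  rw [threshold]
  congr 3
  push_cast
  ring

theorem IsSemistable.injective {E : TwistedHiggs.{u, v₁, v₂, v₃} p q L} {α : ℝ}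
    (hp : 0 < p) (hq : 0 < q) (hE : E.IsSemistable α) (hpq : q ≤ p)
    (hδ : E.V.slope - E.W.slope > -L.degree) (hα : α < E.threshold 0) : E.β.Injective :=
  E.β.injective_of_kerRank_eq_zero (Nat.lt_one_iff.1
    (hE.kerRank_lt hp hq hpq hδ le_rfl (by simpa using hα)))

theorem IsSemistable.lt_kerRank_nat {E : TwistedHiggs.{u, v₁, v₂, v₃} p q L} {α : ℝ}
    (hp : 0 < p) (hq : 0 < q) (hE : E.IsSemistable α) (hpq : q ≤ p)
    (hδ : E.V.slope - E.W.slope < -L.degree) {i : ℕ} (hi : 1 ≤ i)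
    (hα : α < E.threshold (i - 1)) : i < E.β.kerRank := by
  have hp' : (0 : ℝ) < p := by exact_mod_cast hp
  have hpq' : (q : ℝ) ≤ p := by exact_mod_cast hpq
  have hi' : (1 : ℝ) ≤ i := by exact_mod_cast hi
  have h1 : (0 : ℝ) ≤ q * (p - q) := mul_nonneg (Nat.cast_nonneg _) (by linarith)
  have h := hE.lt_kerRank hp hq hpq hδ (by push_cast; rw [sub_add_cancel]; positivity) hα
  omega

theorem IsSemistable.isZero {E : TwistedHiggs.{u, v₁, v₂, v₃} p q L} {α : ℝ}
    (hp : 0 < p) (hq : 0 < q) (hE : E.IsSemistable α) (hpq : q ≤ p)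
    (hδ : E.V.slope - E.W.slope < -L.degree) (h1 : ¬ (p = 1 ∧ q = 1))
    (hα : α < E.threshold (q - 2)) : E.β.IsZero := by
  have hp' : (1 : ℝ) ≤ p := by exact_mod_cast hp
  have hq' : (1 : ℝ) ≤ q := by exact_mod_cast hq
  have hp2 : (2 : ℝ) ≤ p := by
    have : 2 ≤ p := by omega
    exact_mod_cast this
  -- For k = q - 2 the denominator is p(q - 1) + q(p - 1), positive because p ≥ 2. The conclusion q
  -- - 1 < rk(ker β) leaves only full rank.
  have h := hE.lt_kerRank hp hq hpq hδ (by push_cast; nlinarith) hα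
  have := E.β.kerRank_le
  exact E.β.isZero_of_kerRank_eq (by omega)

end TwistedHiggs

end

theorem proposition3p10
    {X : Type u} [TopologicalSpace X] [T2Space X] [CompactSpace X] [ConnectedSpace X]
    [ChartedSpace ℂ X] [IsManifold 𝓘(ℂ) ω X]
    {p q : ℕ} (hp : 0 < p) (hq : 0 < q) (L : HolVB.{u, v₃} X 1)
    (E : TwistedHiggs.{u, v₁, v₂, v₃} p q L) (α : ℝ) (hE : E.IsSemistable α) :
    -- (i)
    (q ≤ p → E.V.slope - E.W.slope > -L.degree →
      (∀ i : ℕ, 1 ≤ i → i ≤ q → α < E.threshold (i - 1) → E.β.kerRank < i) ∧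
      E.threshold 0 = 2 * p * q / (p * q - q ^ 2 + p + q) *
        (E.W.slope - E.V.slope - L.degree) + L.degree ∧
      (α < E.threshold 0 → E.β.Injective)) ∧
    -- (ii)
    (q ≤ p → E.V.slope - E.W.slope < -L.degree →
      (∀ i : ℕ, 1 ≤ i → i ≤ q → α < E.threshold (i - 1) → i < E.β.kerRank) ∧
      E.threshold (q - 2) = 2 * p * q / (2 * p * q - p - q) *
        (E.W.slope - E.V.slope - L.degree) + L.degree ∧
      (¬ (p = 1 ∧ q = 1) → α < E.threshold (q - 2) → E.β.IsZero)) ∧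
    -- (iii)
    (p ≤ q → E.V.slope - E.W.slope < L.degree →
      (∀ j : ℕ, 1 ≤ j → j ≤ p → α > E.threshold' (j - 1) → E.γ.kerRank < j) ∧
      E.threshold' 0 = 2 * p * q / (p * q - p ^ 2 + p + q) *
        (E.W.slope - E.V.slope + L.degree) - L.degree ∧
      (α > E.threshold' 0 → E.γ.Injective)) ∧
    -- (iv)
    (p ≤ q → E.V.slope - E.W.slope > L.degree →
      (∀ j : ℕ, 1 ≤ j → j ≤ p → α > E.threshold' (j - 1) → j < E.γ.kerRank) ∧
      E.threshold' (p - 2) = 2 * p * q / (2 * p * q - p - q) *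
        (E.W.slope - E.V.slope + L.degree) - L.degree ∧
      (¬ (p = 1 ∧ q = 1) → α > E.threshold' (p - 2) → E.γ.IsZero)) := by
  -- The last two statements are the first two for the swapped bundle and -α: `threshold_swap`
  -- reverses both the sign and the inequality.
  have hswap := hE.swap hp
  have hlt : ∀ j, α > E.threshold' j → -α < E.swap.threshold j := fun j h => by
    rw [E.threshold_swap]; linarith
  refine ⟨fun hpq hδ => ⟨fun i hi _ => hE.kerRank_lt hp hq hpq hδ hi, E.threshold_zero,
      hE.injective hp hq hpq hδ⟩,
    fun hpq hδ => ⟨fun i hi _ => hE.lt_kerRank_nat hp hq hpq hδ hi, E.threshold_sub_two,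
      hE.isZero hp hq hpq hδ⟩,
    fun hpq hδ => ?_, fun hpq hδ => ?_⟩
  · have hδ' : E.swap.V.slope - E.swap.W.slope > -L.degree := by
      change E.W.slope - E.V.slope > -L.degree
      linarith
    refine ⟨fun j hj _ h => hswap.kerRank_lt hq hp hpq hδ' hj (hlt _ h), ?_,
      fun h => hswap.injective hq hp hpq hδ' (hlt _ h)⟩
    rw [TwistedHiggs.threshold']
    congr 3
    push_cast
    ring
  · have hδ' : E.swap.V.slope - E.swap.W.slope < -L.degree := by
      change E.W.slope - E.V.slope < -L.degree
      linarith
    refine ⟨fun j hj _ h => hswap.lt_kerRank_nat hq hp hpq hδ' hj (hlt _ h), ?_,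
      fun h1 h => hswap.isZero hq hp hpq hδ' (fun h2 => h1 h2.symm) (hlt _ h)⟩
    rw [TwistedHiggs.threshold']
    congr 3
    push_cast
    ring
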